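/- Let $\mathbb{D}\subset\mathbb{C}$ be the open unit disc and let $\Gamma<PSU(1,1)$ be a Fuchsian group acting freely and cocompactly on $\mathbb{D}$, so that $\Sigma=\mathbb{D}/\Gamma$ is a compact Riemann surface of genus $\ge 2$ (every such surface arises in this way). Let $\Omega=(\mathbb{D}\times\mathbb{D})/\Gamma$, where $\Gamma$ acts diagonally, and let $\mathcal{O}(\Omega)$ be the space of holomorphic functions on $\Omega$, regarded as $\Gamma$-invariant holomorphic functions $f(z,w)$ on $\mathbb{D}\times\mathbb{D}$. For $f\in\mathcal{O}(\Omega)$ and $n\ge 0$ put $$f_n(z)=\frac{1}{n!}\left.\frac{\partial^n}{\partial t^n}\right|_{t=0} f\!\left(z,\frac{t+z}{1+\bar z t}\right),\qquad \varphi_n=f_n(z)\left(\frac{\sqrt2\,dz}{1-|z|^2}\right)^{\otimes n};$$ $\varphi_n$ is a $\Gamma$-invariant $n$-differential, hence a section of $K_\Sigma^{\otimes n}$, called the $n$-th associated differential of $f$. Let $g(z)=2/(1-|z|^2)^2$ be the coefficient of the Poincaré metric, with fundamental form $\omega_g=g\,i\,dz\wedge d\bar z$, let $|(dz)^{\otimes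 n}|_g^2=g^{-n}$, and put $$\|\varphi\|^2=\int_\Sigma|\varphi|_g^2\,\omega_g,\qquad \|f\|_{-1}^2=\pi\sum_{n=0}^\infty\|\varphi_n\|^2\in[0,\infty],\qquad A^2_{-1}(\Omega)=\{f\in\mathcal{O}(\Omega)\mid \|f\|_{-1}<\infty\}.$$ Then the Hardy space $A^2_{-1}(\Omega)$ consists exactly of the constant functions. Moreover, every bounded holomorphic function on $\Omega$ is constant. -/

import Mathlib

open Complex MeasureTheory
open scoped ENNReal UnitDisc ComplexConjugate

/-- The group `PSU(1,1)` of conformal automorphisms of the unit disc, realised faithfully as the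
group of the transformations `z ↦ (α z + β) / (conj β z + conj α)` with `|α|² - |β|² = 1`. -/
def PSU11 : Subgroup (Equiv.Perm 𝔻) where
  carrier := {γ | ∃ α β : ℂ, ‖α‖ ^ 2 - ‖β‖ ^ 2 = 1 ∧
    ∀ z : 𝔻, conj β * z + conj α ≠ 0 ∧ (γ z : ℂ) = (α * z + β) / (conj β * z + conj α)}
  one_mem' := ⟨1, 0, by simp, fun z => by simp⟩
  mul_mem' := by
    rintro γ₁ γ₂ ⟨a, b, h₁, H₁⟩ ⟨c, d, h₂, H₂⟩
    have e₁ : a * conj a - b * conj b = 1 := by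
      rw [Complex.mul_conj', Complex.mul_conj']; exact_mod_cast h₁
    have e₂ : c * conj c - d * conj d = 1 := by
      rw [Complex.mul_conj', Complex.mul_conj']; exact_mod_cast h₂
    refine ⟨a * c + b * conj d, a * d + b * conj c, ?_, fun z => ?_⟩
    · have : (((‖a * c + b * conj d‖ ^ 2 - ‖a * d + b * conj c‖ ^ 2 : ℝ)) : ℂ) = 1 := by
        push_cast
        rw [← Complex.mul_conj', ← Complex.mul_conj']
        simp only [map_add, map_mul, Complex.conj_conj]
        linear_combination (c * conj c - d * conj d) * e₁ + e₂
      exact_mod_cast this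
    · obtain ⟨n₂, E₂⟩ := H₂ z
      obtain ⟨n₁, E₁⟩ := H₁ (γ₂ z)
      rw [E₂] at n₁ E₁
      have k : conj (a * d + b * conj c) * (z : ℂ) + conj (a * c + b * conj d)
          = (conj b * ((c * z + d) / (conj d * z + conj c)) + conj a)
            * (conj d * z + conj c) := by
        simp only [map_add, map_mul, Complex.conj_conj]
        field_simp
        ring
      have k₂ : (a * c + b * conj d) * (z : ℂ) + (a * d + b * conj c)
          = (a * ((c * z + d) / (conj d * z + conj c)) + b) * (conj d * z + conj c) := by
        field_simp
        ring
      rw [k, k₂]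
      refine ⟨mul_ne_zero n₁ n₂, ?_⟩
      rw [Equiv.Perm.mul_apply, E₁, mul_div_mul_right _ _ n₂]
  inv_mem' := by
    rintro γ ⟨a, b, h, H⟩
    have e : a * conj a - b * conj b = 1 := by
      rw [Complex.mul_conj', Complex.mul_conj']; exact_mod_cast h
    refine ⟨conj a, -b, by simpa using h, fun z => ?_⟩
    obtain ⟨n, E⟩ := H (γ⁻¹ z)
    rw [show γ (γ⁻¹ z) = z from γ.apply_symm_apply z] at E
    have k : conj (-b) * (z : ℂ) + conj (conj a)
        = 1 / (conj b * ((γ⁻¹ z : 𝔻) : ℂ) + conj a) := by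
      rw [E, map_neg, Complex.conj_conj]
      field_simp
      linear_combination e
    rw [k]
    refine ⟨one_div_ne_zero n, ?_⟩
    have m := div_mul_cancel₀ (a * ((γ⁻¹ z : 𝔻) : ℂ) + b) n
    rw [E, div_div_eq_mul_div, div_one]
    linear_combination -((γ⁻¹ z : 𝔻) : ℂ) * e - conj a * m

/-- `Γ` is a Fuchsian group (a subgroup of `PSU(1,1)` acting properly discontinuously on the disc)
that acts freely and cocompactly.  The quotient `𝔻 / Γ` is then a compact Riemann surface of genus
at least `2`, and every such surface is of this form. -/
structure IsCocompactFreeFuchsian (Γ : Subgroup (Equiv.Perm 𝔻)) : Prop where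
  le_PSU11 : Γ ≤ PSU11
  properlyDiscontinuous : ProperlyDiscontinuousSMul Γ 𝔻
  free : ∀ γ ∈ Γ, ∀ z : 𝔻, γ z = z → γ = 1
  cocompact : CompactSpace (MulAction.orbitRel.Quotient Γ 𝔻)

/-- The disc bundle `Ω = (𝔻 × 𝔻) / Γ` for the diagonal action `γ (z, w) = (γ z, γ w)`. -/
abbrev DiscBundle (Γ : Subgroup (Equiv.Perm 𝔻)) : Type :=
  MulAction.orbitRel.Quotient Γ (𝔻 × 𝔻)

section

variable (Γ : Subgroup (Equiv.Perm 𝔻))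

open Classical in
/-- The pull-back to the bidisc of a function on `Ω`, as a function on `ℂ × ℂ` (with the
irrelevant value `0` outside the bidisc). -/
noncomputable def bidiscLift (f : DiscBundle Γ → ℂ) (p : ℂ × ℂ) : ℂ :=
  if h : ‖p.1‖ < 1 ∧ ‖p.2‖ < 1 then
    f (Quotient.mk _ (UnitDisc.mk p.1 h.1, UnitDisc.mk p.2 h.2))
  else 0

/-- Holomorphic functions on the complex manifold `Ω`: the covering map `𝔻 × 𝔻 → Ω` being locally
biholomorphic, these are the functions whose pull-back to the bidisc is holomorphic. -/
def IsHolomorphic (f : DiscBundle Γ → ℂ) : Prop :=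
  DifferentiableOn ℂ (bidiscLift Γ f) (Metric.ball 0 1 ×ˢ Metric.ball 0 1)

/-- The pull-back of `f` in the coordinates `(z, t)`, where `t = (w - z) / (1 - conj z * w)`, that
is, `w = (t + z) / (1 + conj z * t)`. -/
noncomputable def fiberLift (f : DiscBundle Γ → ℂ) (z t : ℂ) : ℂ :=
  bidiscLift Γ f (z, (t + z) / (1 + conj z * t))

/-- The `n`-th Taylor coefficient of `f` along the diagonal in the fibre coordinate `t`. -/
noncomputable def taylorCoeff (f : DiscBundle Γ → ℂ) (n : ℕ) (z : ℂ) : ℂ :=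
  iteratedDeriv n (fiberLift Γ f z) 0 / (n.factorial : ℂ)

/-- The `n`-th associated differential `φ_n = f_n(z) (√2 dz / (1 - |z|²))^n` of `f`, a section of
the `n`-th power of the canonical bundle of `𝔻 / Γ`, given by the coefficient of `(dz)^n` in the
uniformizing coordinate `z`. -/
noncomputable def associatedDifferential (f : DiscBundle Γ → ℂ) (n : ℕ) (z : ℂ) : ℂ :=
  taylorCoeff Γ f n z * ((√2 / (1 - ‖z‖ ^ 2) : ℝ) : ℂ) ^ n

/-- The coefficient `g` of the Poincaré metric, whose fundamental form is `g i dz ∧ conj dz`, that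
is, `2 g` times Lebesgue measure. -/
noncomputable def poincareCoeff (z : ℂ) : ℝ := 2 / (1 - ‖z‖ ^ 2) ^ 2

/-- The Dirichlet fundamental domain of `Γ` with centre `0`: the hyperbolic distance of `z` to `0`
is an increasing function of `‖z‖`, so it consists of the points that are closest to `0` in
their orbit. -/
def dirichletDomain : Set ℂ :=
  {z | ∃ h : ‖z‖ < 1, ∀ γ ∈ Γ, ‖z‖ ≤ ‖(γ (UnitDisc.mk z h) : ℂ)‖}

/-- The squared `L²` norm `∫ |φ|²_g ω_g` over `𝔻 / Γ` of an `n`-differential `φ = u(z) (dz)^n`,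
where `|(dz)^n|²_g = g^(-n)`. -/
noncomputable def differentialNormSq (n : ℕ) (u : ℂ → ℂ) : ℝ≥0∞ :=
  ∫⁻ z in dirichletDomain Γ,
    ENNReal.ofReal (‖u z‖ ^ 2 * (poincareCoeff z ^ n)⁻¹ * (2 * poincareCoeff z))

/-- The squared Hardy norm `π ∑ ‖φ_n‖²`, with values in `[0, ∞]`. -/
noncomputable def hardyNormSq (f : DiscBundle Γ → ℂ) : ℝ≥0∞ :=
  ENNReal.ofReal Real.pi *
    ∑' n : ℕ, differentialNormSq Γ n (associatedDifferential Γ f n)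

/-- The Hardy space of `Ω`: the holomorphic functions of finite Hardy norm. -/
def hardySpace : Set (DiscBundle Γ → ℂ) :=
  {f | IsHolomorphic Γ f ∧ hardyNormSq Γ f < ⊤}

end

/-! Let F be the lift of f to the bidisc and let M(r) be `fiberMean`: the integral of ∑ |f_n(z)|²
r^(2n) over z modulo Γ, nondecreasing in r. A finite Hardy norm gives M(1) < ∞
(`fiberMean_one_ne_top_of_hardyNormSq`), and so does boundedness, by Parseval on the fibre circles
(`fiberMean_one_ne_top_of_bounded`). Both claims thus follow once M(1) < ∞ is shown to force F to be
constant.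

Take two weights κ₁, κ₂ of the pseudo-hyperbolic distance, with masses m₁, m₂. Since F(·, w) is
holomorphic, the κ₁-average of |F(a, w)|² about z exceeds m₁ |F(z, w)|² by exactly the κ₁-average of
|F(a, w) - F(z, w)|². Integrate this against κ₂ in w, and over z modulo Γ. By diagonal invariance
the fundamental domain can be moved from z to a (`lintegral_unfold`); the free z-integral then
composes the two kernels into one of mass m₁m₂. With V the variation and E the energy,
`kernelVariation_add_le` reads V(κ₁, κ₂) + m₁ E(κ₂) ≤ m₁ m₂ M(1).

If κ₂ lives at distances at least r, then E(κ₂) ≥ m₂ M(r), so V(κ₁, κ₂) / m₂ ≤ m₁ (M(1) - M(r)).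
Since F(a, w) - F(z, w) is holomorphic in w, moving κ₂ inwards can only decrease V / m₂, so a fixed
inner weight obeys the same bound (`kernelVariation_innerWeight_add_le`). Letting r tend to 1 gives
V = 0 (`kernelVariation_eq_zero`).

Hence for some z, F(a, w) = F(z, w) for all a and all w near z, and by the identity theorem F does
not depend on its first variable. It is then a Γ-invariant holomorphic function of w alone, whose
modulus has a maximum by cocompactness, so it is constant (`exists_eq_const`). -/

/-! ### The automorphisms of the unit disc -/

theorem norm_conj_mul_add_conj (α β z : ℂ) : ‖β * conj z + α‖ = ‖conj β * z + conj α‖ := by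
  rw [← Complex.norm_conj]; simp

theorem PSU11.continuous {γ : Equiv.Perm 𝔻} (hγ : γ ∈ PSU11) : Continuous γ := by
  obtain ⟨α, β, -, H⟩ := hγ
  rw [UnitDisc.isEmbedding_coe.continuous_iff]
  have : ((↑) : 𝔻 → ℂ) ∘ γ = fun z : 𝔻 => (α * z + β) / (conj β * z + conj α) :=
    funext fun z => (H z).2
  rw [this]
  exact Continuous.div (by fun_prop) (by fun_prop) fun z => (H z).1

theorem one_sub_conj_mul_ne_zero (z w : 𝔻) : 1 - conj (z : ℂ) * w ≠ 0 := by
  intro h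
  have h1 : ‖conj (z : ℂ) * w‖ < 1 := by
    rw [norm_mul, Complex.norm_conj]
    exact mul_lt_one_of_nonneg_of_lt_one_left (norm_nonneg _) z.norm_lt_one w.norm_lt_one.le
  rw [← sub_eq_zero.mp h] at h1
  simp at h1

theorem one_add_conj_mul_ne_zero (z w : 𝔻) : 1 + conj (z : ℂ) * w ≠ 0 := by
  simpa using one_sub_conj_mul_ne_zero z (-w)

theorem norm_div_lt_one (z w : 𝔻) : ‖((w : ℂ) + z) / (1 + conj (z : ℂ) * w)‖ < 1 := by
  have h : 0 < ‖1 + conj (z : ℂ) * w‖ := norm_pos_iff.mpr (one_add_conj_mul_ne_zero z w)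
  rw [norm_div, div_lt_one h]
  refine lt_of_pow_lt_pow_left₀ 2 h.le ?_
  have key : ‖1 + conj (z : ℂ) * w‖ ^ 2 - ‖(w : ℂ) + z‖ ^ 2
      = (1 - ‖(z : ℂ)‖ ^ 2) * (1 - ‖(w : ℂ)‖ ^ 2) := by
    simp only [← Complex.normSq_eq_norm_sq, Complex.normSq_apply]
    simp
    ring
  have hz := z.sq_norm_lt_one
  have hw := w.sq_norm_lt_one
  nlinarith [mul_pos (sub_pos.mpr hz) (sub_pos.mpr hw)]

/-- The automorphism `t ↦ (t + z) / (1 + conj z * t)` of the disc, which takes `0` to `z`. -/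
noncomputable def diskMove (z : 𝔻) : Equiv.Perm 𝔻 where
  toFun t := UnitDisc.mk _ (norm_div_lt_one z t)
  invFun t := UnitDisc.mk _ (norm_div_lt_one (-z) t)
  left_inv t := by
    rw [← UnitDisc.coe_inj]
    have h := one_add_conj_mul_ne_zero z t
    have h' := one_add_conj_mul_ne_zero (-z) (UnitDisc.mk _ (norm_div_lt_one z t))
    simp only [UnitDisc.coe_mk, UnitDisc.coe_neg, map_neg] at h' ⊢
    rw [div_eq_iff h']
    generalize hD : 1 + conj (z : ℂ) * t = D at *
    field_simp
    linear_combination ((t : ℂ) + z) * hD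
  right_inv t := by
    rw [← UnitDisc.coe_inj]
    have h := one_add_conj_mul_ne_zero (-z) t
    have h' := one_add_conj_mul_ne_zero z (UnitDisc.mk _ (norm_div_lt_one (-z) t))
    simp only [UnitDisc.coe_mk, UnitDisc.coe_neg, map_neg] at h h' ⊢
    rw [div_eq_iff h']
    generalize hD : 1 + -conj (z : ℂ) * t = D at *
    field_simp
    linear_combination ((t : ℂ) - z) * hD

theorem coe_diskMove (z t : 𝔻) :
    (diskMove z t : ℂ) = (t + z) / (1 + conj (z : ℂ) * t) := rfl

theorem diskMove_zero_right (z : 𝔻) : diskMove z 0 = z := by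
  rw [← UnitDisc.coe_inj, coe_diskMove]; simp

theorem diskMove_mem (z : 𝔻) : diskMove z ∈ PSU11 := by
  have hz : 0 < 1 - ‖(z : ℂ)‖ ^ 2 := sub_pos.mpr z.sq_norm_lt_one
  -- This factor normalises the matrix with rows (1, z), (conj z, 1) to determinant 1.
  set s : ℝ := (√(1 - ‖(z : ℂ)‖ ^ 2))⁻¹ with hs
  have hs0 : 0 < s := inv_pos.mpr (Real.sqrt_pos.mpr hz)
  have hsc : (s : ℂ) ≠ 0 := by exact_mod_cast hs0.ne'
  refine ⟨s, s * z, ?_, fun t => ?_⟩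
  · rw [norm_mul, mul_pow, Complex.norm_real, Real.norm_eq_abs, sq_abs, ← mul_one_sub, hs,
      inv_pow, Real.sq_sqrt hz.le]
    exact inv_mul_cancel₀ hz.ne'
  · have e : conj ((s : ℂ) * z) * t + conj (s : ℂ) = s * (1 + conj (z : ℂ) * t) := by
      simp only [map_mul, Complex.conj_ofReal]; ring
    rw [e]
    refine ⟨mul_ne_zero hsc (one_add_conj_mul_ne_zero z t), ?_⟩
    rw [coe_diskMove, ← mul_add, mul_div_mul_left _ _ hsc]

theorem circle_toPerm_mem (c : Circle) : (MulAction.toPerm c : Equiv.Perm 𝔻) ∈ PSU11 := by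
  -- The pair (α, 0) acts as multiplication by α / conj α = α² when |α| = 1, so a square root of c
  -- is needed.
  obtain ⟨α, hα⟩ := IsAlgClosed.exists_pow_nat_eq (c : ℂ) (n := 2) (by norm_num)
  have hn : ‖α‖ ^ 2 = 1 := by rw [← norm_pow, hα, Circle.norm_coe]
  have h1 : conj α * α = 1 := by rw [Complex.conj_mul']; exact_mod_cast hn
  refine ⟨α, 0, by simp [hn], fun z => ?_⟩
  have h0 : conj α ≠ 0 := left_ne_zero_of_mul_eq_one h1
  refine ⟨by simpa using h0, ?_⟩
  rw [MulAction.toPerm_apply, UnitDisc.coe_circle_smul, ← hα]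
  simp only [add_zero, map_zero, zero_mul, zero_add]
  rw [eq_div_iff h0]
  linear_combination (α * z) * h1

/-- The pseudo-hyperbolic distance on the disc. -/
noncomputable def pseudoDist (z w : 𝔻) : ℝ := ‖((w : ℂ) - z) / (1 - conj (z : ℂ) * w)‖

theorem pseudoDist_zero_left (t : 𝔻) : pseudoDist 0 t = ‖(t : ℂ)‖ := by simp [pseudoDist]

theorem pseudoDist_comm (z w : 𝔻) : pseudoDist z w = pseudoDist w z := by
  rw [pseudoDist, pseudoDist, norm_div, norm_div, norm_sub_rev]
  congr 1
  rw [← Complex.norm_conj]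
  simp [mul_comm]

theorem pseudoDist_lt_one (z w : 𝔻) : pseudoDist z w < 1 := by
  have := norm_div_lt_one (-z) w
  simpa [pseudoDist, sub_eq_add_neg] using this

/-- Under γ, both w - z and 1 - conj z * w are divided by automorphy factors that differ only by a
conjugation, so the modulus of their quotient is unchanged. -/
theorem pseudoDist_smul {γ : Equiv.Perm 𝔻} (hγ : γ ∈ PSU11) (z w : 𝔻) :
    pseudoDist (γ z) (γ w) = pseudoDist z w := by
  obtain ⟨α, β, h, H⟩ := hγ
  have e : α * conj α - β * conj β = 1 := by
    rw [Complex.mul_conj', Complex.mul_conj']; exact_mod_cast h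
  obtain ⟨nz, Ez⟩ := H z
  obtain ⟨nw, Ew⟩ := H w
  have nz' : β * conj (z : ℂ) + α ≠ 0 := by
    rw [← norm_pos_iff, norm_conj_mul_add_conj, norm_pos_iff]; exact nz
  have e1 : (γ w : ℂ) - γ z
      = (w - z) / ((conj β * w + conj α) * (conj β * z + conj α)) := by
    rw [Ez, Ew, div_sub_div _ _ nw nz]
    congr 1
    linear_combination ((w : ℂ) - z) * e
  have e2 : 1 - conj (γ z : ℂ) * γ w
      = (1 - conj (z : ℂ) * w) / ((conj β * w + conj α) * (β * conj (z : ℂ) + α)) := by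
    rw [Ez, Ew]; simp only [map_div₀, map_add, map_mul, Complex.conj_conj]
    rw [div_mul_div_comm, one_sub_div (mul_ne_zero nz' nw), mul_comm (β * conj (z : ℂ) + α)]
    congr 1
    linear_combination (1 - conj (z : ℂ) * w) * e
  rw [pseudoDist, pseudoDist, e1, e2]
  simp only [norm_div, norm_mul, norm_conj_mul_add_conj]
  have h1 := norm_ne_zero_iff.mpr nz
  have h2 := norm_ne_zero_iff.mpr nw
  rw [div_div_div_cancel_right₀ (mul_ne_zero h2 h1)]

theorem continuous_pseudoDist : Continuous fun p : 𝔻 × 𝔻 => pseudoDist p.1 p.2 := by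
  have h1 : Continuous fun p : 𝔻 × 𝔻 => (p.1 : ℂ) := UnitDisc.continuous_coe.comp continuous_fst
  have h2 : Continuous fun p : 𝔻 × 𝔻 => (p.2 : ℂ) := UnitDisc.continuous_coe.comp continuous_snd
  exact ((h2.sub h1).div (continuous_const.sub ((Complex.continuous_conj.comp h1).mul h2))
    fun p => one_sub_conj_mul_ne_zero p.1 p.2).norm

theorem continuous_diskMove : Continuous fun p : 𝔻 × 𝔻 => diskMove p.1 p.2 := by
  rw [UnitDisc.isEmbedding_coe.continuous_iff]
  have h1 : Continuous fun p : 𝔻 × 𝔻 => (p.1 : ℂ) := UnitDisc.continuous_coe.comp continuous_fst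
  have h2 : Continuous fun p : 𝔻 × 𝔻 => (p.2 : ℂ) := UnitDisc.continuous_coe.comp continuous_snd
  exact (h2.add h1).div (continuous_const.add ((Complex.continuous_conj.comp h1).mul h2))
    fun p => one_add_conj_mul_ne_zero p.1 p.2

attribute [irreducible] pseudoDist

/-! ### The hyperbolic measure -/

noncomputable instance : MeasurableSpace 𝔻 := borel 𝔻

instance : BorelSpace 𝔻 := ⟨rfl⟩

theorem UnitDisc.isOpenEmbedding_coe : Topology.IsOpenEmbedding ((↑) : 𝔻 → ℂ) :=
  Metric.isOpen_ball.isOpenEmbedding_subtypeVal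

theorem UnitDisc.measurableEmbedding_coe : MeasurableEmbedding ((↑) : 𝔻 → ℂ) :=
  UnitDisc.isOpenEmbedding_coe.measurableEmbedding

theorem UnitDisc.range_coe : Set.range ((↑) : 𝔻 → ℂ) = Metric.ball 0 1 :=
  Subtype.range_coe

instance : SecondCountableTopology 𝔻 := UnitDisc.isOpenEmbedding_coe.secondCountableTopology

/-- The density of the hyperbolic measure with respect to Lebesgue measure. -/
noncomputable def hypDensity (z : ℂ) : ℝ≥0∞ := ENNReal.ofReal (2 * poincareCoeff z)

theorem measurable_hypDensity : Measurable hypDensity := by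
  unfold hypDensity poincareCoeff
  fun_prop

/-- The measure on the disc given by the fundamental form of the Poincaré metric. -/
noncomputable def hypMeasure : Measure 𝔻 := (volume.withDensity hypDensity).comap (↑)

theorem lintegral_hypMeasure (H : ℂ → ℝ≥0∞) :
    ∫⁻ z : 𝔻, H z ∂hypMeasure = ∫⁻ z in Metric.ball 0 1, hypDensity z * H z := by
  rw [hypMeasure, ← UnitDisc.measurableEmbedding_coe.lintegral_map (f := H),
    UnitDisc.measurableEmbedding_coe.map_comap, UnitDisc.range_coe,
    setLIntegral_withDensity_eq_setLIntegral_mul_non_measurable₀ _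
      measurable_hypDensity.aemeasurable _ Metric.isOpen_ball.measurableSet]
  · rfl
  · exact Filter.Eventually.of_forall fun z => ENNReal.ofReal_lt_top

theorem hypMeasure_apply (s : Set 𝔻) (hs : MeasurableSet s) :
    hypMeasure s = ∫⁻ z in (↑) '' s, hypDensity z := by
  rw [hypMeasure, UnitDisc.measurableEmbedding_coe.comap_apply, withDensity_apply _
    (UnitDisc.measurableEmbedding_coe.measurableSet_image.mpr hs)]

/-- Change of variables: the real Jacobian is |conj β z + conj α|^(-4), while 1 - |z|² gets divided
by |conj β z + conj α|², and its square is what enters the density. -/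
theorem hypMeasure_image {γ : Equiv.Perm 𝔻} (hγ : γ ∈ PSU11) (s : Set 𝔻) (hs : MeasurableSet s) :
    hypMeasure (γ '' s) = hypMeasure s := by
  have hmeas : MeasurableSet (γ '' s) := by
    rw [Equiv.image_eq_preimage_symm]
    exact (PSU11.continuous (inv_mem hγ)).measurable hs
  obtain ⟨α, β, h, H⟩ := hγ
  have e : α * conj α - β * conj β = 1 := by
    rw [Complex.mul_conj', Complex.mul_conj']; exact_mod_cast h
  let m : ℂ → ℂ := fun z => (α * z + β) / (conj β * z + conj α)
  have him : ((↑) : 𝔻 → ℂ) '' (γ '' s) = m '' ((↑) '' s) := by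
    rw [Set.image_image, Set.image_image]
    exact Set.image_congr fun z _ => (H z).2
  have hsc : MeasurableSet (((↑) : 𝔻 → ℂ) '' s) :=
    UnitDisc.measurableEmbedding_coe.measurableSet_image.mpr hs
  let m' : ℂ → ℂ →L[ℝ] ℂ := fun z =>
    (ContinuousLinearMap.toSpanSingleton ℂ (1 / (conj β * z + conj α) ^ 2)).restrictScalars ℝ
  have hd : ∀ z ∈ ((↑) : 𝔻 → ℂ) '' s, HasFDerivWithinAt m (m' z) (((↑) : 𝔻 → ℂ) '' s) z := by
    rintro _ ⟨z, -, rfl⟩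
    have n := (H z).1
    have d1 : HasDerivAt (fun z : ℂ => α * z + β) α z := by
      simpa using ((hasDerivAt_id (z : ℂ)).const_mul α).add_const β
    have d2 : HasDerivAt (fun z : ℂ => conj β * z + conj α) (conj β) z := by
      simpa using ((hasDerivAt_id (z : ℂ)).const_mul (conj β)).add_const (conj α)
    have d := (d1.div d2 n).congr_deriv (g' := 1 / (conj β * z + conj α) ^ 2) (by
      congr 1; linear_combination e)
    exact (d.hasFDerivAt.restrictScalars ℝ).hasFDerivWithinAt
  have hinj : Set.InjOn m (((↑) : 𝔻 → ℂ) '' s) := by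
    rintro _ ⟨z, -, rfl⟩ _ ⟨w, -, rfl⟩ hzw
    have : (γ z : ℂ) = γ w := by rw [(H z).2, (H w).2]; exact hzw
    rw [γ.injective (UnitDisc.coe_injective this)]
  rw [hypMeasure_apply _ hmeas, hypMeasure_apply _ hs, him,
    lintegral_image_eq_lintegral_abs_det_fderiv_mul _ hsc hd hinj]
  refine setLIntegral_congr_fun hsc ?_
  rintro _ ⟨z, -, rfl⟩
  have n := norm_pos_iff.mpr (H z).1
  have hdet : (m' z).det = (‖conj β * z + conj α‖ ^ 4)⁻¹ := by
    simp [m', ContinuousLinearMap.det, LinearMap.det_restrictScalars,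
      Algebra.norm_complex_eq, Complex.normSq_eq_norm_sq, ← pow_mul]
  have hm : 1 - ‖m z‖ ^ 2 = (1 - ‖(z : ℂ)‖ ^ 2) / ‖conj β * z + conj α‖ ^ 2 := by
    have : ‖conj β * z + conj α‖ ^ 2 - ‖α * z + β‖ ^ 2
        = (‖α‖ ^ 2 - ‖β‖ ^ 2) * (1 - ‖(z : ℂ)‖ ^ 2) := by
      simp only [← Complex.normSq_eq_norm_sq, Complex.normSq_apply]
      simp
      ring
    rw [h, one_mul] at this
    rw [← this, sub_div, div_self (by positivity)]
    simp only [m, norm_div, div_pow]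
  dsimp only
  rw [hypDensity, ← ENNReal.ofReal_mul (abs_nonneg _), hdet, hypDensity]
  congr 1
  simp only [poincareCoeff]
  rw [hm, abs_of_nonneg (by positivity)]
  have : 1 - ‖(z : ℂ)‖ ^ 2 ≠ 0 := (sub_pos.mpr z.sq_norm_lt_one).ne'
  field_simp

theorem measurePreserving_of_mem_PSU11 {γ : Equiv.Perm 𝔻} (hγ : γ ∈ PSU11) :
    MeasurePreserving γ hypMeasure hypMeasure := by
  refine ⟨(PSU11.continuous hγ).measurable, Measure.ext fun s hs => ?_⟩
  rw [Measure.map_apply (PSU11.continuous hγ).measurable hs,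
    ← hypMeasure_image hγ _ ((PSU11.continuous hγ).measurable hs),
    Set.image_preimage_eq _ γ.surjective]

theorem lintegral_comp_PSU11 {γ : Equiv.Perm 𝔻} (hγ : γ ∈ PSU11) {H : 𝔻 → ℝ≥0∞}
    (hH : Measurable H) : ∫⁻ z, H (γ z) ∂hypMeasure = ∫⁻ z, H z ∂hypMeasure :=
  (measurePreserving_of_mem_PSU11 hγ).lintegral_comp hH

/-- The weight making the hyperbolic measure a multiple of Lebesgue measure. -/
noncomputable def discWeight (r : ℝ) : ℝ≥0∞ := ENNReal.ofReal ((1 - r ^ 2) ^ 2)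

theorem continuous_discWeight : Continuous discWeight := by
  unfold discWeight
  exact ENNReal.continuous_ofReal.comp (by fun_prop)

theorem lintegral_discWeight_lt_top : ∫⁻ z : 𝔻, discWeight ‖(z : ℂ)‖ ∂hypMeasure < ⊤ := by
  rw [lintegral_hypMeasure fun z => discWeight ‖z‖]
  calc ∫⁻ z in Metric.ball (0 : ℂ) 1, hypDensity z * discWeight ‖z‖
      ≤ ∫⁻ z in Metric.ball (0 : ℂ) 1, 4 := by
        refine setLIntegral_mono measurable_const fun z _ => ?_
        rw [hypDensity, discWeight, ← ENNReal.ofReal_mul (by unfold poincareCoeff; positivity)]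
        refine ENNReal.ofReal_le_of_le_toReal ?_
        simp only [poincareCoeff, ENNReal.toReal_ofNat]
        rcases eq_or_ne (1 - ‖z‖ ^ 2) 0 with h | h
        · simp [h]
        · apply le_of_eq; field_simp; norm_num
    _ < ⊤ := by
        rw [setLIntegral_const]
        exact ENNReal.mul_lt_top (by simp) measure_ball_lt_top

instance : SigmaFinite hypMeasure := by
  refine SigmaFinite.of_map (f := ((↑) : 𝔻 → ℂ)) _
    UnitDisc.measurableEmbedding_coe.measurable.aemeasurable ?_
  rw [hypMeasure, UnitDisc.measurableEmbedding_coe.map_comap]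
  have : SigmaFinite (volume.withDensity hypDensity) :=
    SigmaFinite.withDensity_of_ne_top
      (Filter.Eventually.of_forall fun z => ENNReal.ofReal_ne_top)
  infer_instance

instance : hypMeasure.IsOpenPosMeasure := by
  refine ⟨fun U hU hne h0 => ?_⟩
  rw [hypMeasure_apply U hU.measurableSet] at h0
  have hUo := UnitDisc.isOpenEmbedding_coe.isOpenMap U hU
  rw [lintegral_eq_zero_iff measurable_hypDensity] at h0
  have h1 : ∀ᵐ z ∂volume.restrict (((↑) : 𝔻 → ℂ) '' U), False := by
    filter_upwards [h0, ae_restrict_mem hUo.measurableSet] with z hz hzU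
    obtain ⟨w, -, rfl⟩ := hzU
    have : 0 < 1 - ‖(w : ℂ)‖ ^ 2 := sub_pos.mpr w.sq_norm_lt_one
    have hp : 0 < 2 * poincareCoeff w := by unfold poincareCoeff; positivity
    simp only [hypDensity, Pi.zero_apply, ENNReal.ofReal_eq_zero] at hz
    exact absurd hz (not_le.mpr hp)
  rw [Filter.eventually_false_iff_eq_bot, ae_eq_bot, Measure.restrict_eq_zero] at h1
  exact hUo.measure_ne_zero volume (hne.image _) h1

/-- Markov's inequality for the integrable function `discWeight`, which is at least `discWeight r`
on the smaller disc. -/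
theorem hypMeasure_norm_le_lt_top {r : ℝ} (hr : r < 1) :
    hypMeasure {z : 𝔻 | ‖(z : ℂ)‖ ≤ r} < ⊤ := by
  rcases lt_or_ge r 0 with h0 | h0
  · have : {z : 𝔻 | ‖(z : ℂ)‖ ≤ r} = ∅ :=
      Set.eq_empty_of_forall_notMem fun z hz => (norm_nonneg (z : ℂ)).not_gt (hz.trans_lt h0)
    simp [this]
  have hpos : 0 < 1 - r ^ 2 := by nlinarith
  have hc : discWeight r ≠ 0 := by
    rw [discWeight, Ne, ENNReal.ofReal_eq_zero, not_le]; positivity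
  have hle : discWeight r * hypMeasure {z : 𝔻 | ‖(z : ℂ)‖ ≤ r}
      ≤ ∫⁻ z : 𝔻, discWeight ‖(z : ℂ)‖ ∂hypMeasure := by
    refine le_trans ?_ (mul_meas_ge_le_lintegral
      (continuous_discWeight.comp UnitDisc.continuous_coe.norm).measurable (discWeight r))
    refine mul_le_mul_right (measure_mono fun z hz => ?_) _
    refine ENNReal.ofReal_le_ofReal (pow_le_pow_left₀ hpos.le ?_ 2)
    have := pow_le_pow_left₀ (norm_nonneg (z : ℂ)) hz 2
    linarith
  by_contra h
  rw [not_lt, top_le_iff] at h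
  rw [h, ENNReal.mul_top hc] at hle
  exact lintegral_discWeight_lt_top.ne (top_le_iff.mp hle)

/-! ### Parseval's identity for power series -/

/-- Absolute summability makes the series converge uniformly, hence in L², where the characters are
orthonormal. -/
theorem lintegral_enorm_sq_of_hasSum_fourier {c : ℕ → ℂ} (hc : Summable fun n => ‖c n‖)
    {G : AddCircle (1 : ℝ) → ℂ} (hG : ∀ x, HasSum (fun n : ℕ => c n * fourier (n : ℤ) x) (G x)) :
    ∫⁻ x, ‖G x‖ₑ ^ 2 ∂AddCircle.haarAddCircle = ∑' n, ‖c n‖ₑ ^ 2 := by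
  have : Fact ((0 : ℝ) < 1) := ⟨one_pos⟩
  have hs : Summable fun n : ℕ => c n • (fourier (n : ℤ) : C(AddCircle (1 : ℝ), ℂ)) := by
    refine Summable.of_norm (hc.congr fun n => ?_)
    rw [norm_smul, fourier_norm, mul_one]
  set g : C(AddCircle (1 : ℝ), ℂ) := ∑' n : ℕ, c n • (fourier (n : ℤ) : C(AddCircle (1 : ℝ), ℂ))
    with hg
  have hgG : ∀ x, g x = G x := fun x => by
    refine HasSum.unique ?_ (hG x)
    exact (ContinuousMap.evalCLM ℂ x).hasSum hs.hasSum
  let L := ContinuousMap.toLp (E := ℂ) 2 (AddCircle.haarAddCircle (T := (1 : ℝ))) ℂ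
  have hL : HasSum (fun n : ℕ => c n • fourierLp (T := (1 : ℝ)) 2 (n : ℤ)) (L g) := by
    have := L.hasSum hs.hasSum
    simpa only [map_smul] using this
  have ho : Orthonormal ℂ fun n : ℕ => fourierLp (T := (1 : ℝ)) 2 (n : ℤ) :=
    orthonormal_fourier.comp _ Nat.cast_injective
  have hsum : HasSum (fun n => ‖c n‖ ^ 2) (‖L g‖ ^ 2) := by
    have h1 := ((continuous_norm.pow 2).tendsto _).comp hL
    refine h1.congr fun s => ?_
    simp only [Function.comp_apply]
    have h2 := ho.inner_sum c c s
    rw [inner_self_eq_norm_sq_to_K] at h2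
    have h3 : ((‖∑ i ∈ s, c i • fourierLp (T := (1 : ℝ)) 2 (i : ℤ)‖ ^ 2 : ℝ) : ℂ)
        = ((∑ i ∈ s, ‖c i‖ ^ 2 : ℝ) : ℂ) := by
      push_cast
      refine h2.trans ?_
      exact Finset.sum_congr rfl fun i _ => Complex.conj_mul' _
    exact_mod_cast h3
  have hnorm : ‖L g‖ₑ ^ 2 = ∫⁻ x, ‖G x‖ₑ ^ 2 ∂AddCircle.haarAddCircle := by
    rw [Lp.enorm_def, eLpNorm_congr_ae (ContinuousMap.coeFn_toLp _ g),
      eLpNorm_eq_lintegral_rpow_enorm_toReal two_ne_zero ENNReal.ofNat_ne_top]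
    rw [← ENNReal.rpow_natCast, ← ENNReal.rpow_mul]
    simp [hgG]
  rw [← hnorm, ← ofReal_norm, ← ENNReal.ofReal_pow (norm_nonneg _), ← hsum.tsum_eq,
    ENNReal.ofReal_tsum_of_nonneg (fun n => by positivity) hsum.summable]
  refine tsum_congr fun n => ?_
  rw [ENNReal.ofReal_pow (norm_nonneg _), ofReal_norm]

/-- The `n`-th Taylor coefficient at `0`. -/
noncomputable def coeffAtZero (h : ℂ → ℂ) (n : ℕ) : ℂ := iteratedDeriv n h 0 / (n.factorial : ℂ)

theorem hasSum_coeffAtZero {h : ℂ → ℂ} (hh : DifferentiableOn ℂ h (Metric.ball 0 1)) {z : ℂ}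
    (hz : ‖z‖ < 1) : HasSum (fun n => coeffAtZero h n * z ^ n) (h z) := by
  have := hasSum_taylorSeries_on_ball hh (mem_ball_zero_iff.mpr hz)
  refine this.congr_fun fun n => ?_
  simp only [sub_zero, smul_eq_mul, coeffAtZero]
  ring

/-- The sum of the squared norms of the terms of the Taylor series of `h` on the circle of
radius `r`. -/
noncomputable def sqSeries (h : ℂ → ℂ) (r : ℝ) : ℝ≥0∞ :=
  ∑' n, ‖coeffAtZero h n‖ₑ ^ 2 * ENNReal.ofReal r ^ (2 * n)

theorem sqSeries_mono (h : ℂ → ℂ) : Monotone (sqSeries h) := fun r s hrs => by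
  unfold sqSeries
  gcongr

theorem sqSeries_one (h : ℂ → ℂ) : sqSeries h 1 = ∑' n, ‖coeffAtZero h n‖ₑ ^ 2 := by
  simp [sqSeries]

theorem lintegral_circle_enorm_sq {h : ℂ → ℂ} (hh : DifferentiableOn ℂ h (Metric.ball 0 1))
    {z : ℂ} (hz : ‖z‖ < 1) :
    ∫⁻ x : AddCircle (1 : ℝ), ‖h (AddCircle.toCircle x * z)‖ₑ ^ 2 ∂AddCircle.haarAddCircle
      = sqSeries h ‖z‖ := by
  have hs := (hasSum_coeffAtZero hh hz).summable.norm
  rw [lintegral_enorm_sq_of_hasSum_fourier (c := fun n => coeffAtZero h n * z ^ n) hs, sqSeries]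
  · refine tsum_congr fun n => ?_
    rw [enorm_mul, enorm_pow, mul_pow, ofReal_norm, ← pow_mul, mul_comm n 2]
  · intro x
    have hx : ‖(AddCircle.toCircle x : ℂ) * z‖ < 1 := by
      rwa [norm_mul, Circle.norm_coe, one_mul]
    refine (hasSum_coeffAtZero hh hx).congr_fun fun n => ?_
    rw [fourier_apply, AddCircle.toCircle_zsmul]
    simp only [zpow_natCast, Circle.coe_pow]
    ring

/-- Rotations preserve both the measure and k, so the integrand may be averaged over the circle
first; Parseval evaluates that average. -/
theorem lintegral_mul_enorm_sq {k : 𝔻 → ℝ≥0∞} (hk : Measurable k)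
    (hrot : ∀ (c : Circle) (t : 𝔻), k (c • t) = k t) {h : ℂ → ℂ}
    (hh : DifferentiableOn ℂ h (Metric.ball 0 1)) :
    ∫⁻ t : 𝔻, k t * ‖h t‖ₑ ^ 2 ∂hypMeasure
      = ∫⁻ t : 𝔻, k t * sqSeries h ‖(t : ℂ)‖ ∂hypMeasure := by
  have hc : Continuous fun t : 𝔻 => h t :=
    hh.continuousOn.comp_continuous UnitDisc.continuous_coe fun t =>
      mem_ball_zero_iff.mpr t.norm_lt_one
  have hm : Measurable fun t : 𝔻 => k t * ‖h t‖ₑ ^ 2 := hk.mul (hc.enorm.measurable.pow_const 2)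
  have hsm : Continuous fun p : 𝔻 × AddCircle (1 : ℝ) => AddCircle.toCircle p.2 • p.1 := by
    rw [UnitDisc.isEmbedding_coe.continuous_iff]
    exact ((continuous_subtype_val.comp (AddCircle.continuous_toCircle.comp continuous_snd)).mul
      (UnitDisc.continuous_coe.comp continuous_fst))
  calc ∫⁻ t : 𝔻, k t * ‖h t‖ₑ ^ 2 ∂hypMeasure
      = ∫⁻ x : AddCircle (1 : ℝ), ∫⁻ t : 𝔻, k t * ‖h t‖ₑ ^ 2 ∂hypMeasure
          ∂AddCircle.haarAddCircle := by simp
    _ = ∫⁻ x : AddCircle (1 : ℝ), ∫⁻ t : 𝔻, k t * ‖h ((AddCircle.toCircle x • t : 𝔻) : ℂ)‖ₑ ^ 2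
          ∂hypMeasure ∂AddCircle.haarAddCircle := by
        refine lintegral_congr fun x => ?_
        rw [← lintegral_comp_PSU11 (circle_toPerm_mem (AddCircle.toCircle x)) hm]
        simp only [MulAction.toPerm_apply, hrot]
    _ = ∫⁻ t : 𝔻, ∫⁻ x : AddCircle (1 : ℝ), k t * ‖h ((AddCircle.toCircle x • t : 𝔻) : ℂ)‖ₑ ^ 2
          ∂AddCircle.haarAddCircle ∂hypMeasure := by
        rw [lintegral_lintegral_swap]
        refine Measurable.aemeasurable ?_
        refine (hk.comp measurable_snd).mul (Measurable.pow_const ?_ 2)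
        exact (hc.enorm.comp (hsm.comp continuous_swap)).measurable
    _ = _ := by
        refine lintegral_congr fun t => ?_
        rw [lintegral_const_mul]
        · simp only [UnitDisc.coe_circle_smul]
          rw [lintegral_circle_enorm_sq hh t.norm_lt_one]
        · exact ((hc.enorm.comp (hsm.comp (Continuous.prodMk_right t))).measurable.pow_const 2)

/-- Only the zeroth coefficient changes. This orthogonality is what turns the mean value property
into an exact identity for the variation. -/
theorem sqSeries_sub_const (h : ℂ → ℂ) (r : ℝ) :
    sqSeries (fun t => h t - h 0) r + ‖h 0‖ₑ ^ 2 = sqSeries h r := by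
  have h1 : ∀ n, coeffAtZero (fun t => h t - h 0) (n + 1) = coeffAtZero h (n + 1) := fun n => by
    simp only [coeffAtZero]
    rw [iteratedDeriv_succ', iteratedDeriv_succ']
    simp
  have hsplit : ∀ g : ℂ → ℂ, sqSeries g r = ‖g 0‖ₑ ^ 2
      + ∑' n, ‖coeffAtZero g (n + 1)‖ₑ ^ 2 * ENNReal.ofReal r ^ (2 * (n + 1)) := fun g => by
    rw [sqSeries, tsum_eq_zero_add' ENNReal.summable]
    simp [coeffAtZero]
  rw [hsplit, hsplit]
  simp only [h1, sub_self, enorm_zero]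
  rw [zero_pow two_ne_zero, zero_add, add_comm]

/-! ### The Dirichlet domain and unfolding -/

theorem isCompact_norm_le {r : ℝ} (hr : r < 1) : IsCompact {z : 𝔻 | ‖(z : ℂ)‖ ≤ r} := by
  rw [UnitDisc.isEmbedding_coe.isCompact_iff]
  convert isCompact_closedBall (0 : ℂ) r using 1
  ext z
  simp only [Set.mem_image, Set.mem_ofPred_eq, mem_closedBall_zero_iff]
  exact ⟨fun ⟨w, hw, e⟩ => e ▸ hw, fun h => ⟨UnitDisc.mk z (h.trans_lt hr), h, rfl⟩⟩

/-- The Dirichlet domain with centre `0` as a subset of the disc. -/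
def dirichletSet (Γ : Subgroup (Equiv.Perm 𝔻)) : Set 𝔻 :=
  {z | ∀ γ ∈ Γ, ‖(z : ℂ)‖ ≤ ‖(γ z : ℂ)‖}

theorem image_dirichletSet (Γ : Subgroup (Equiv.Perm 𝔻)) :
    ((↑) : 𝔻 → ℂ) '' dirichletSet Γ = dirichletDomain Γ := by
  ext z
  constructor
  · rintro ⟨w, hw, rfl⟩
    exact ⟨w.norm_lt_one, hw⟩
  · rintro ⟨h, hz⟩
    exact ⟨UnitDisc.mk z h, hz, rfl⟩

namespace IsCocompactFreeFuchsian

variable {Γ : Subgroup (Equiv.Perm 𝔻)} (hΓ : IsCocompactFreeFuchsian Γ)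

include hΓ in
theorem isClosed_dirichletSet : IsClosed (dirichletSet Γ) := by
  have : dirichletSet Γ = ⋂ γ ∈ Γ, {z : 𝔻 | ‖(z : ℂ)‖ ≤ ‖(γ z : ℂ)‖} := by
    ext z; simp [dirichletSet]
  rw [this]
  refine isClosed_biInter fun γ hγ => isClosed_le UnitDisc.continuous_coe.norm ?_
  exact (UnitDisc.continuous_coe.comp (PSU11.continuous (hΓ.le_PSU11 hγ))).norm

include hΓ in
theorem measurableSet_dirichletSet : MeasurableSet (dirichletSet Γ) :=
  hΓ.isClosed_dirichletSet.measurableSet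

include hΓ in
theorem continuousConstSMul : ContinuousConstSMul Γ 𝔻 :=
  ⟨fun γ => PSU11.continuous (hΓ.le_PSU11 γ.2)⟩

include hΓ in
-- The images of the discs of radius 1 - 1/(n + 1) are an increasing open cover of the compact
-- quotient, so one of them is everything.
theorem exists_norm_lt : ∃ r < 1, ∀ z : 𝔻, ∃ γ ∈ Γ, ‖(γ z : ℂ)‖ < r := by
  have := hΓ.continuousConstSMul
  have := hΓ.cocompact
  let q : 𝔻 → MulAction.orbitRel.Quotient Γ 𝔻 := Quotient.mk _
  let r : ℕ → ℝ := fun n => 1 - 1 / ((n : ℝ) + 1)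
  have hr : StrictMono r := fun m n hmn => by
    have : (m : ℝ) < n := by exact_mod_cast hmn
    simp only [r]
    gcongr
  have hr1 : ∀ n, r n < 1 := fun n => by
    simp only [r]
    linarith [Nat.one_div_pos_of_nat (α := ℝ) (n := n)]
  let U : ℕ → Set (MulAction.orbitRel.Quotient Γ 𝔻) := fun n => q '' {z : 𝔻 | ‖(z : ℂ)‖ < r n}
  have hU : ∀ n, IsOpen (U n) := fun n =>
    isOpenMap_quotient_mk'_mul _ (isOpen_lt UnitDisc.continuous_coe.norm continuous_const)
  have hcov : Set.univ ⊆ ⋃ n, U n := by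
    intro x _
    induction x using Quotient.inductionOn with
    | h z =>
      obtain ⟨n, hn⟩ := exists_nat_one_div_lt (sub_pos.mpr z.norm_lt_one)
      exact Set.mem_iUnion.mpr ⟨n, z, by simp only [r, Set.mem_ofPred_eq]; linarith, rfl⟩
  have hmono : Monotone U := fun m n hmn =>
    Set.image_mono fun z (hz : ‖(z : ℂ)‖ < r m) => hz.trans_le (hr.monotone hmn)
  have hdir : Directed (· ⊆ ·) U := hmono.directed_le
  obtain ⟨n, hn⟩ := isCompact_univ.elim_directed_cover U hU hcov hdir
  refine ⟨r n, hr1 n, fun z => ?_⟩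
  obtain ⟨w, hw, e⟩ := hn (Set.mem_univ (q z))
  obtain ⟨γ, hγ⟩ := Quotient.exact e
  exact ⟨γ, γ.2, by rw [show (γ : Equiv.Perm 𝔻) z = w from hγ]; exact hw⟩

include hΓ in
theorem exists_dirichletSet_subset :
    ∃ r < 1, dirichletSet Γ ⊆ {z : 𝔻 | ‖(z : ℂ)‖ ≤ r} := by
  obtain ⟨r, hr, h⟩ := hΓ.exists_norm_lt
  refine ⟨r, hr, fun z hz => ?_⟩
  obtain ⟨γ, hγ, hn⟩ := h z
  exact (hz γ hγ).trans hn.le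

include hΓ in
theorem hypMeasure_dirichletSet_lt_top : hypMeasure (dirichletSet Γ) < ⊤ := by
  obtain ⟨r, hr, h⟩ := hΓ.exists_dirichletSet_subset
  exact (measure_mono h).trans_lt (hypMeasure_norm_le_lt_top hr)

include hΓ in
theorem finite_setOf_norm_le {r : ℝ} (hr : r < 1) :
    {γ : Γ | ∃ z : 𝔻, ‖(z : ℂ)‖ ≤ r ∧ ‖((γ : Equiv.Perm 𝔻) z : ℂ)‖ ≤ r}.Finite := by
  have := hΓ.properlyDiscontinuous
  have h := ProperlyDiscontinuousSMul.finite_disjoint_inter_image (Γ := Γ)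
    (isCompact_norm_le hr) (isCompact_norm_le hr)
  refine h.subset fun γ ⟨z, h1, h2⟩ => ?_
  exact ⟨_, ⟨z, h1, rfl⟩, h2⟩

include hΓ in
theorem countable : Countable Γ := by
  have h : (Set.univ : Set Γ) ⊆ ⋃ n : ℕ, {γ : Γ | ∃ z : 𝔻, ‖(z : ℂ)‖ ≤ 1 - 1 / ((n : ℝ) + 1) ∧
      ‖((γ : Equiv.Perm 𝔻) z : ℂ)‖ ≤ 1 - 1 / ((n : ℝ) + 1)} := by
    intro γ _
    obtain ⟨n, hn⟩ := exists_nat_one_div_lt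
      (sub_pos.mpr ((γ : Equiv.Perm 𝔻) 0).norm_lt_one)
    refine Set.mem_iUnion.mpr ⟨n, 0, ?_, by linarith⟩
    have := norm_nonneg (((γ : Equiv.Perm 𝔻) 0 : 𝔻) : ℂ)
    rw [UnitDisc.coe_zero, norm_zero]
    linarith
  rw [← Set.countable_univ_iff]
  refine (Set.countable_iUnion fun n => ?_).mono h
  refine (hΓ.finite_setOf_norm_le ?_).countable
  linarith [Nat.one_div_pos_of_nat (α := ℝ) (n := n)]

include hΓ in
-- By proper discontinuity only finitely many γ bring z no farther from 0 than it already is, so the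
-- orbit has a point of least modulus.
theorem exists_mem_dirichletSet (z : 𝔻) : ∃ γ ∈ Γ, γ z ∈ dirichletSet Γ := by
  let S : Set Γ := {γ | ‖((γ : Equiv.Perm 𝔻) z : ℂ)‖ ≤ ‖(z : ℂ)‖}
  have hS : S.Finite := (hΓ.finite_setOf_norm_le z.norm_lt_one).subset fun γ h => ⟨z, le_rfl, h⟩
  obtain ⟨γ, hγS, hγ⟩ := Set.exists_min_image S
    (fun γ => ‖((γ : Equiv.Perm 𝔻) z : ℂ)‖) hS
    ⟨1, le_refl ‖(z : ℂ)‖⟩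
  refine ⟨γ, γ.2, fun δ hδ => ?_⟩
  rcases le_or_gt ‖(δ ((γ : Equiv.Perm 𝔻) z) : ℂ)‖ ‖(z : ℂ)‖ with h | h
  · exact hγ (⟨δ, hδ⟩ * γ) h
  · exact le_trans hγS h.le

end IsCocompactFreeFuchsian

/-- The number of translates of `z` in the Dirichlet domain. -/
noncomputable def dirichletCount (Γ : Subgroup (Equiv.Perm 𝔻)) (z : 𝔻) : ℝ≥0∞ :=
  ∑' γ : Γ, (dirichletSet Γ).indicator 1 ((γ : Equiv.Perm 𝔻) z)

/-- A weight supported on the Dirichlet domain whose translates sum to `1`. -/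
noncomputable def dirichletWeight (Γ : Subgroup (Equiv.Perm 𝔻)) (z : 𝔻) : ℝ≥0∞ :=
  (dirichletSet Γ).indicator 1 z / dirichletCount Γ z

theorem dirichletCount_smul (Γ : Subgroup (Equiv.Perm 𝔻)) (γ : Γ) (z : 𝔻) :
    dirichletCount Γ ((γ : Equiv.Perm 𝔻) z) = dirichletCount Γ z :=
  (Equiv.mulRight γ).tsum_eq
    fun δ : Γ => (dirichletSet Γ).indicator (1 : 𝔻 → ℝ≥0∞) ((δ : Equiv.Perm 𝔻) z)

namespace IsCocompactFreeFuchsian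

variable {Γ : Subgroup (Equiv.Perm 𝔻)} (hΓ : IsCocompactFreeFuchsian Γ)

include hΓ in
theorem one_le_dirichletCount (z : 𝔻) : 1 ≤ dirichletCount Γ z := by
  obtain ⟨γ, hγ, h⟩ := hΓ.exists_mem_dirichletSet z
  refine le_trans ?_ (ENNReal.le_tsum (⟨γ, hγ⟩ : Γ))
  simp [h]

include hΓ in
theorem dirichletCount_ne_top (z : 𝔻) : dirichletCount Γ z ≠ ⊤ := by
  obtain ⟨r, hr, hD⟩ := hΓ.exists_dirichletSet_subset
  -- A disc large enough to contain both z and the Dirichlet domain.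
  have hfin := hΓ.finite_setOf_norm_le (max_lt hr z.norm_lt_one)
  rw [dirichletCount, tsum_eq_sum (s := hfin.toFinset)]
  · refine ENNReal.sum_ne_top.mpr fun γ _ => ?_
    exact ne_top_of_le_ne_top ENNReal.one_ne_top (Set.indicator_le_self' (by simp) _)
  · intro γ hγ
    refine Set.indicator_of_notMem (fun h => hγ ?_) _
    rw [Set.Finite.mem_toFinset]
    exact ⟨z, le_max_right _ _, (hD h).trans (le_max_left _ _)⟩

include hΓ in
theorem dirichletWeight_le (z : 𝔻) :
    dirichletWeight Γ z ≤ (dirichletSet Γ).indicator 1 z :=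
  ENNReal.div_le_of_le_mul (le_mul_of_one_le_right zero_le (hΓ.one_le_dirichletCount z))

include hΓ in
theorem dirichletWeight_ne_zero {z : 𝔻} (hz : z ∈ dirichletSet Γ) : dirichletWeight Γ z ≠ 0 := by
  simp [dirichletWeight, hz, hΓ.dirichletCount_ne_top z]

include hΓ in
-- Translates of the Dirichlet domain may overlap along its boundary. Dividing by the invariant
-- count gives an exact partition of unity, so the boundary need not be shown to be null.
theorem tsum_dirichletWeight (z : 𝔻) :
    ∑' γ : Γ, dirichletWeight Γ ((γ : Equiv.Perm 𝔻) z) = 1 := by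
  simp only [dirichletWeight, dirichletCount_smul, div_eq_mul_inv]
  rw [ENNReal.tsum_mul_right]
  exact ENNReal.mul_inv_cancel (one_pos.trans_le (hΓ.one_le_dirichletCount z)).ne'
    (hΓ.dirichletCount_ne_top z)

include hΓ in
theorem measurable_dirichletWeight : Measurable (dirichletWeight Γ) := by
  have := hΓ.countable
  have h1 : Measurable ((dirichletSet Γ).indicator (1 : 𝔻 → ℝ≥0∞)) :=
    measurable_one.indicator hΓ.measurableSet_dirichletSet
  refine h1.div (Measurable.tsum fun γ => h1.comp ?_)
  exact (PSU11.continuous (hΓ.le_PSU11 γ.2)).measurable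

include hΓ in
theorem lintegral_dirichletWeight_lt_top : ∫⁻ z, dirichletWeight Γ z ∂hypMeasure < ⊤ := by
  refine (lintegral_mono hΓ.dirichletWeight_le).trans_lt ?_
  rw [lintegral_indicator_one hΓ.measurableSet_dirichletSet]
  exact hΓ.hypMeasure_dirichletSet_lt_top

include hΓ in
/-- The integral over `(𝔻 × 𝔻) / Γ` may be computed with either factor restricted to a fundamental
domain. -/
theorem lintegral_unfold {H : 𝔻 → 𝔻 → ℝ≥0∞} (hH : Measurable fun p : 𝔻 × 𝔻 => H p.1 p.2)
    (hinv : ∀ γ ∈ Γ, ∀ z a, H (γ z) (γ a) = H z a) :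
    ∫⁻ z, dirichletWeight Γ z * ∫⁻ a, H z a ∂hypMeasure ∂hypMeasure
      = ∫⁻ a, dirichletWeight Γ a * ∫⁻ z, H z a ∂hypMeasure ∂hypMeasure := by
  have := hΓ.countable
  have hχ := hΓ.measurable_dirichletWeight
  have hcont : ∀ γ : Γ, Measurable (γ : Equiv.Perm 𝔻) := fun γ =>
    (PSU11.continuous (hΓ.le_PSU11 γ.2)).measurable
  set χ := dirichletWeight Γ with hχdef
  have hpres : ∀ γ : Γ, MeasurePreserving (Prod.map (γ : Equiv.Perm 𝔻) (γ : Equiv.Perm 𝔻))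
      (hypMeasure.prod hypMeasure) (hypMeasure.prod hypMeasure) := fun γ =>
    (measurePreserving_of_mem_PSU11 (hΓ.le_PSU11 γ.2)).prod
      (measurePreserving_of_mem_PSU11 (hΓ.le_PSU11 γ.2))
  -- The diagonal action of γ preserves H and the product measure, so it carries the translate from
  -- the second factor to the first, where it becomes γ⁻¹.
  have key : ∀ γ : Γ,
      ∫⁻ p : 𝔻 × 𝔻, χ p.1 * (χ ((γ : Equiv.Perm 𝔻) p.2) * H p.1 p.2) ∂hypMeasure.prod hypMeasure
      = ∫⁻ p : 𝔻 × 𝔻, χ p.2 * (χ (((γ⁻¹ : Γ) : Equiv.Perm 𝔻) p.1) * H p.1 p.2)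
          ∂hypMeasure.prod hypMeasure := by
    intro γ
    rw [← (hpres γ).lintegral_comp (f := fun p : 𝔻 × 𝔻 =>
      χ p.2 * (χ (((γ⁻¹ : Γ) : Equiv.Perm 𝔻) p.1) * H p.1 p.2))]
    · refine lintegral_congr fun p => ?_
      simp only [Prod.map_fst, Prod.map_snd, hinv γ γ.2]
      rw [show ((γ⁻¹ : Γ) : Equiv.Perm 𝔻) ((γ : Equiv.Perm 𝔻) p.1) = p.1 from
        (γ : Equiv.Perm 𝔻).symm_apply_apply p.1]
      ring
    · exact (hχ.comp measurable_snd).mul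
        ((hχ.comp ((hcont γ⁻¹).comp measurable_fst)).mul hH)
  have hm1 : ∀ γ : Γ, Measurable fun p : 𝔻 × 𝔻 =>
      χ p.1 * (χ ((γ : Equiv.Perm 𝔻) p.2) * H p.1 p.2) := fun γ =>
    (hχ.comp measurable_fst).mul ((hχ.comp ((hcont γ).comp measurable_snd)).mul hH)
  have hm2 : ∀ γ : Γ, Measurable fun p : 𝔻 × 𝔻 =>
      χ p.2 * (χ ((γ : Equiv.Perm 𝔻) p.1) * H p.1 p.2) := fun γ =>
    (hχ.comp measurable_snd).mul ((hχ.comp ((hcont γ).comp measurable_fst)).mul hH)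
  calc ∫⁻ z, χ z * ∫⁻ a, H z a ∂hypMeasure ∂hypMeasure
      = ∫⁻ p : 𝔻 × 𝔻, χ p.1 * H p.1 p.2 ∂hypMeasure.prod hypMeasure := by
        rw [lintegral_prod (fun p : 𝔻 × 𝔻 => χ p.1 * H p.1 p.2)
          ((hχ.comp measurable_fst).mul hH).aemeasurable]
        refine lintegral_congr fun z => ?_
        exact (lintegral_const_mul _ (hH.comp measurable_prodMk_left)).symm
    -- The partition of unity is inserted in the second variable; after `key` and inversion in Γ it
    -- is removed in the first.
    _ = ∫⁻ p : 𝔻 × 𝔻, ∑' γ : Γ, χ p.1 * (χ ((γ : Equiv.Perm 𝔻) p.2) * H p.1 p.2)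
          ∂hypMeasure.prod hypMeasure := by
        refine lintegral_congr fun p => ?_
        rw [ENNReal.tsum_mul_left, ENNReal.tsum_mul_right, hχdef, hΓ.tsum_dirichletWeight, one_mul]
    _ = ∑' γ : Γ, ∫⁻ p : 𝔻 × 𝔻, χ p.2 * (χ (((γ⁻¹ : Γ) : Equiv.Perm 𝔻) p.1) * H p.1 p.2)
          ∂hypMeasure.prod hypMeasure := by
        rw [lintegral_tsum fun γ => (hm1 γ).aemeasurable]
        exact tsum_congr key
    _ = ∑' γ : Γ, ∫⁻ p : 𝔻 × 𝔻, χ p.2 * (χ ((γ : Equiv.Perm 𝔻) p.1) * H p.1 p.2)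
          ∂hypMeasure.prod hypMeasure :=
        (Equiv.inv Γ).tsum_eq fun γ : Γ => ∫⁻ p : 𝔻 × 𝔻,
          χ p.2 * (χ ((γ : Equiv.Perm 𝔻) p.1) * H p.1 p.2) ∂hypMeasure.prod hypMeasure
    _ = ∫⁻ p : 𝔻 × 𝔻, χ p.2 * H p.1 p.2 ∂hypMeasure.prod hypMeasure := by
        rw [← lintegral_tsum fun γ => (hm2 γ).aemeasurable]
        refine lintegral_congr fun p => ?_
        rw [ENNReal.tsum_mul_left, ENNReal.tsum_mul_right, hχdef, hΓ.tsum_dirichletWeight, one_mul]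
    _ = _ := by
        rw [lintegral_prod_symm (fun p : 𝔻 × 𝔻 => χ p.2 * H p.1 p.2)
          ((hχ.comp measurable_snd).mul hH).aemeasurable]
        refine lintegral_congr fun a => ?_
        exact lintegral_const_mul (χ a) (f := fun z => H z a)
          (hH.comp measurable_prodMk_right)

end IsCocompactFreeFuchsian

/-! ### Invariant kernels -/

theorem pseudoDist_diskMove (z t : 𝔻) : pseudoDist z (diskMove z t) = ‖(t : ℂ)‖ := by
  nth_rewrite 1 [← diskMove_zero_right z]
  rw [pseudoDist_smul (diskMove_mem z), pseudoDist_zero_left]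

theorem measurable_kernel {κ : ℝ → ℝ≥0∞} (hκ : Measurable κ) :
    Measurable fun p : 𝔻 × 𝔻 => κ (pseudoDist p.1 p.2) :=
  hκ.comp continuous_pseudoDist.measurable

theorem measurable_kernel_right {κ : ℝ → ℝ≥0∞} (hκ : Measurable κ) (z : 𝔻) :
    Measurable fun w : 𝔻 => κ (pseudoDist z w) :=
  (measurable_kernel hκ).comp measurable_prodMk_left

theorem measurable_kernel_left {κ : ℝ → ℝ≥0∞} (hκ : Measurable κ) (w : 𝔻) :
    Measurable fun z : 𝔻 => κ (pseudoDist z w) := by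
  simp only [fun z => pseudoDist_comm z w]
  exact measurable_kernel_right hκ w

theorem measurable_kernel_norm {κ : ℝ → ℝ≥0∞} (hκ : Measurable κ) :
    Measurable fun t : 𝔻 => κ ‖(t : ℂ)‖ :=
  hκ.comp UnitDisc.continuous_coe.norm.measurable

/-- The total mass of the measure with density `κ (pseudoDist z w)`, for any `z`. -/
noncomputable def kernelMass (κ : ℝ → ℝ≥0∞) : ℝ≥0∞ := ∫⁻ t : 𝔻, κ ‖(t : ℂ)‖ ∂hypMeasure

theorem lintegral_kernel_mul {κ : ℝ → ℝ≥0∞} (hκ : Measurable κ) (z : 𝔻) {H : 𝔻 → ℝ≥0∞}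
    (hH : Measurable H) :
    ∫⁻ w, κ (pseudoDist z w) * H w ∂hypMeasure
      = ∫⁻ t : 𝔻, κ ‖(t : ℂ)‖ * H (diskMove z t) ∂hypMeasure := by
  rw [← lintegral_comp_PSU11 (H := fun w => κ (pseudoDist z w) * H w) (diskMove_mem z)
    ((measurable_kernel_right hκ z).mul hH)]
  simp only [pseudoDist_diskMove]

theorem lintegral_kernel {κ : ℝ → ℝ≥0∞} (hκ : Measurable κ) (z : 𝔻) :
    ∫⁻ w, κ (pseudoDist z w) ∂hypMeasure = kernelMass κ := by
  simpa [kernelMass] using lintegral_kernel_mul hκ z measurable_one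

/-- The function `h` in the coordinate `t` centred at `z`. -/
noncomputable def recenter (h : ℂ → ℂ) (z t : ℂ) : ℂ := h ((t + z) / (1 + conj z * t))

theorem recenter_coe (h : ℂ → ℂ) (z t : 𝔻) : recenter h z t = h (diskMove z t) := rfl

theorem recenter_zero (h : ℂ → ℂ) (z : ℂ) : recenter h z 0 = h z := by simp [recenter]

theorem differentiableOn_recenter {h : ℂ → ℂ} (hh : DifferentiableOn ℂ h (Metric.ball 0 1))
    (z : 𝔻) : DifferentiableOn ℂ (recenter h z) (Metric.ball 0 1) := by
  refine hh.comp ?_ fun t ht => ?_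
  · refine DifferentiableOn.div (by fun_prop) (by fun_prop) fun t ht => ?_
    exact one_add_conj_mul_ne_zero z (UnitDisc.mk t (mem_ball_zero_iff.mp ht))
  · exact mem_ball_zero_iff.mpr (norm_div_lt_one z (UnitDisc.mk t (mem_ball_zero_iff.mp ht)))

theorem continuous_coe_of_differentiableOn {h : ℂ → ℂ}
    (hh : DifferentiableOn ℂ h (Metric.ball 0 1)) : Continuous fun t : 𝔻 => h t :=
  hh.continuousOn.comp_continuous UnitDisc.continuous_coe fun t =>
    mem_ball_zero_iff.mpr t.norm_lt_one

theorem lintegral_kernel_mul_enorm_sq {κ : ℝ → ℝ≥0∞} (hκ : Measurable κ) (z : 𝔻) {h : ℂ → ℂ}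
    (hh : DifferentiableOn ℂ h (Metric.ball 0 1)) :
    ∫⁻ w : 𝔻, κ (pseudoDist z w) * ‖h w‖ₑ ^ 2 ∂hypMeasure
      = ∫⁻ t : 𝔻, κ ‖(t : ℂ)‖ * sqSeries (recenter h z) ‖(t : ℂ)‖ ∂hypMeasure := by
  rw [lintegral_kernel_mul hκ z
    ((continuous_coe_of_differentiableOn hh).enorm.measurable.pow_const 2)]
  simp only [← recenter_coe]
  refine lintegral_mul_enorm_sq (k := fun t : 𝔻 => κ ‖(t : ℂ)‖)
    (measurable_kernel_norm hκ) (fun c t => ?_) (differentiableOn_recenter hh z)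
  rw [UnitDisc.coe_circle_smul, norm_mul, Circle.norm_coe, one_mul]

/-- The quadratic mean value property: on each circle centred at z the constant h z is orthogonal to
h - h z. The additive form stays valid when the integrals are infinite. -/
theorem lintegral_kernel_mul_enorm_sub_sq {κ : ℝ → ℝ≥0∞} (hκ : Measurable κ)
    (z : 𝔻) {h : ℂ → ℂ} (hh : DifferentiableOn ℂ h (Metric.ball 0 1)) :
    ∫⁻ w : 𝔻, κ (pseudoDist z w) * ‖h w - h z‖ₑ ^ 2 ∂hypMeasure + kernelMass κ * ‖h z‖ₑ ^ 2
      = ∫⁻ w : 𝔻, κ (pseudoDist z w) * ‖h w‖ₑ ^ 2 ∂hypMeasure := by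
  have hk := measurable_kernel_norm hκ
  rw [lintegral_kernel_mul_enorm_sq hκ z hh,
    lintegral_kernel_mul_enorm_sq (h := fun w => h w - h z) hκ z (hh.sub_const _), kernelMass,
    ← lintegral_mul_const _ hk, ← lintegral_add_right _ (hk.mul_const _)]
  refine lintegral_congr fun t => ?_
  rw [← mul_add, ← sqSeries_sub_const (recenter h z), recenter_zero]
  rfl

/-- Circle means of |h|² increase with the radius, so a weight living outside radius r averages at
least the value at r. The next lemma is the counterpart for a weight living inside. -/
theorem kernelMass_mul_sqSeries_le {κ : ℝ → ℝ≥0∞} (hκ : Measurable κ)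
    {r : ℝ} (hr : ∀ x < r, κ x = 0) (z : 𝔻) {h : ℂ → ℂ}
    (hh : DifferentiableOn ℂ h (Metric.ball 0 1)) :
    kernelMass κ * sqSeries (recenter h z) r
      ≤ ∫⁻ w : 𝔻, κ (pseudoDist z w) * ‖h w‖ₑ ^ 2 ∂hypMeasure := by
  rw [lintegral_kernel_mul_enorm_sq hκ z hh, kernelMass,
    ← lintegral_mul_const _ (measurable_kernel_norm hκ)]
  refine lintegral_mono fun t => ?_
  dsimp only
  rcases lt_or_ge ‖(t : ℂ)‖ r with h1 | h1
  · simp [hr _ h1]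
  · exact mul_le_mul_right (sqSeries_mono _ h1) _

theorem le_kernelMass_mul_sqSeries {κ : ℝ → ℝ≥0∞} (hκ : Measurable κ)
    {r : ℝ} (hr : ∀ x > r, κ x = 0) (z : 𝔻) {h : ℂ → ℂ}
    (hh : DifferentiableOn ℂ h (Metric.ball 0 1)) :
    ∫⁻ w : 𝔻, κ (pseudoDist z w) * ‖h w‖ₑ ^ 2 ∂hypMeasure
      ≤ kernelMass κ * sqSeries (recenter h z) r := by
  rw [lintegral_kernel_mul_enorm_sq hκ z hh, kernelMass,
    ← lintegral_mul_const _ (measurable_kernel_norm hκ)]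
  refine lintegral_mono fun t => ?_
  dsimp only
  rcases lt_or_ge r ‖(t : ℂ)‖ with h1 | h1
  · simp [hr _ h1]
  · exact mul_le_mul_right (sqSeries_mono _ h1) _

/-- The composition of two invariant kernels. -/
noncomputable def kernelComp (κ₁ κ₂ : ℝ → ℝ≥0∞) (a w : 𝔻) : ℝ≥0∞ :=
  ∫⁻ z : 𝔻, κ₁ (pseudoDist z a) * κ₂ (pseudoDist z w) ∂hypMeasure

section kernelComp

variable {κ₁ κ₂ : ℝ → ℝ≥0∞} (hκ₁ : Measurable κ₁) (hκ₂ : Measurable κ₂)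

include hκ₁ hκ₂

theorem lintegral_kernel_swap (z : 𝔻) {u : 𝔻 → 𝔻 → ℝ≥0∞}
    (hu : Measurable fun p : 𝔻 × 𝔻 => u p.1 p.2) :
    ∫⁻ a, κ₁ (pseudoDist z a) * ∫⁻ w, κ₂ (pseudoDist z w) * u a w ∂hypMeasure ∂hypMeasure
      = ∫⁻ w, κ₂ (pseudoDist z w) * ∫⁻ a, κ₁ (pseudoDist z a) * u a w ∂hypMeasure
          ∂hypMeasure := by
  have m₁ := measurable_kernel_right hκ₁ z
  have m₂ := measurable_kernel_right hκ₂ z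
  calc _ = ∫⁻ a, ∫⁻ w, κ₁ (pseudoDist z a) * (κ₂ (pseudoDist z w) * u a w)
        ∂hypMeasure ∂hypMeasure := by
        refine lintegral_congr fun a => (lintegral_const_mul _ ?_).symm
        exact m₂.mul (hu.comp measurable_prodMk_left)
    _ = ∫⁻ w, ∫⁻ a, κ₁ (pseudoDist z a) * (κ₂ (pseudoDist z w) * u a w)
        ∂hypMeasure ∂hypMeasure := by
        refine lintegral_lintegral_swap (Measurable.aemeasurable ?_)
        exact (m₁.comp measurable_fst).mul ((m₂.comp measurable_snd).mul hu)
    _ = _ := by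
        refine lintegral_congr fun w => ?_
        rw [← lintegral_const_mul]
        · exact lintegral_congr fun a => mul_left_comm _ _ _
        · exact m₁.mul (hu.comp measurable_prodMk_right)

theorem lintegral_kernelComp_mul (a : 𝔻) {u : 𝔻 → ℝ≥0∞} (hu : Measurable u) :
    ∫⁻ z, κ₁ (pseudoDist z a) * ∫⁻ w, κ₂ (pseudoDist z w) * u w ∂hypMeasure ∂hypMeasure
      = ∫⁻ w, kernelComp κ₁ κ₂ a w * u w ∂hypMeasure := by
  have m₁ := measurable_kernel_left hκ₁ a
  calc _ = ∫⁻ z, ∫⁻ w, κ₁ (pseudoDist z a) * κ₂ (pseudoDist z w) * u w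
        ∂hypMeasure ∂hypMeasure := by
        refine lintegral_congr fun z => ?_
        refine (lintegral_const_mul _ (f := fun w => κ₂ (pseudoDist z w) * u w)
          ((measurable_kernel_right hκ₂ z).mul hu)).symm.trans ?_
        exact lintegral_congr fun w => (mul_assoc _ _ _).symm
    _ = ∫⁻ w, ∫⁻ z, κ₁ (pseudoDist z a) * κ₂ (pseudoDist z w) * u w
        ∂hypMeasure ∂hypMeasure := by
        refine lintegral_lintegral_swap (Measurable.aemeasurable ?_)
        exact ((m₁.comp measurable_fst).mul (measurable_kernel hκ₂)).mul (hu.comp measurable_snd)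
    _ = _ := by
        refine lintegral_congr fun w => lintegral_mul_const _ ?_
        exact m₁.mul (measurable_kernel_left hκ₂ w)

theorem measurable_kernelComp_right (a : 𝔻) : Measurable (kernelComp κ₁ κ₂ a) := by
  have h₁ : Measurable fun p : 𝔻 × 𝔻 => κ₁ (pseudoDist p.2 a) :=
    (measurable_kernel_left hκ₁ a).comp measurable_snd
  have h₂ : Measurable fun p : 𝔻 × 𝔻 => κ₂ (pseudoDist p.2 p.1) :=
    (measurable_kernel hκ₂).comp (measurable_snd.prodMk measurable_fst)
  have h : Measurable fun w : 𝔻 =>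
      ∫⁻ z : 𝔻, κ₁ (pseudoDist z a) * κ₂ (pseudoDist z w) ∂hypMeasure :=
    (h₁.mul h₂).lintegral_prod_right'
  exact h

/-- Substitute γ z for the integration variable. The invariance lets a be moved to 0, where the
composed kernel is radial. -/
theorem kernelComp_smul {γ : Equiv.Perm 𝔻} (hγ : γ ∈ PSU11) (a w : 𝔻) :
    kernelComp κ₁ κ₂ (γ a) (γ w) = kernelComp κ₁ κ₂ a w := by
  rw [kernelComp, ← lintegral_comp_PSU11 hγ
    (H := fun z => κ₁ (pseudoDist z (γ a)) * κ₂ (pseudoDist z (γ w)))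
    ((measurable_kernel_left hκ₁ _).mul (measurable_kernel_left hκ₂ _))]
  simp only [pseudoDist_smul hγ, kernelComp]

theorem lintegral_kernelComp (a : 𝔻) :
    ∫⁻ w, kernelComp κ₁ κ₂ a w ∂hypMeasure = kernelMass κ₁ * kernelMass κ₂ := by
  have h := lintegral_kernelComp_mul hκ₁ hκ₂ a measurable_one
  simp only [Pi.one_apply, mul_one, lintegral_kernel hκ₂] at h
  rw [← h, lintegral_mul_const _ (measurable_kernel_left hκ₁ a)]
  simp only [fun z => pseudoDist_comm z a, lintegral_kernel hκ₁]

end kernelComp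

/-! ### Continuity of Taylor coefficients -/

/-- Cauchy's formula on a fixed circle inside the disc. It serves to deduce continuity of the
coefficients in a parameter: the fibre coordinate involves conj z, so they are not holomorphic in z
in general. -/
theorem coeffAtZero_eq_circleIntegral {h : ℂ → ℂ}
    (hh : DifferentiableOn ℂ h (Metric.ball 0 1)) (n : ℕ) :
    coeffAtZero h n
      = (2 * Real.pi * I : ℂ)⁻¹ * ∮ z in C(0, 1 / 2), (1 / z) ^ n • z⁻¹ • h z := by
  have h1 := (hh.mono (Metric.closedBall_subset_ball (by norm_num :
    ((1 / 2 : NNReal) : ℝ) < 1))).hasFPowerSeriesOnBall (by norm_num)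
  have h2 := h1.factorial_smul 1 n
  rw [cauchyPowerSeries_apply] at h2
  rw [coeffAtZero, iteratedDeriv_eq_iteratedFDeriv, ← h2, nsmul_eq_mul,
    mul_div_cancel_left₀ _ (by exact_mod_cast n.factorial_ne_zero)]
  simp

theorem continuous_coeffAtZero {h : 𝔻 → ℂ → ℂ}
    (hh : ∀ z, DifferentiableOn ℂ (h z) (Metric.ball 0 1))
    (hc : Continuous fun p : 𝔻 × 𝔻 => h p.1 p.2) (n : ℕ) :
    Continuous fun z => coeffAtZero (h z) n := by
  simp only [fun z => coeffAtZero_eq_circleIntegral (hh z) n]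
  have hlt : ∀ θ : ℝ, ‖circleMap 0 (1 / 2) θ‖ < 1 := fun θ => by
    rw [norm_circleMap_zero]; norm_num
  have hne : ∀ θ : ℝ, circleMap 0 (1 / 2) θ ≠ 0 := fun θ => circleMap_ne_center (by norm_num)
  have hcm : Continuous fun p : 𝔻 × ℝ => circleMap 0 (1 / 2) p.2 :=
    (continuous_circleMap 0 (1 / 2)).comp continuous_snd
  have hD : Continuous fun p : 𝔻 × ℝ => h p.1 (circleMap 0 (1 / 2) p.2) := by
    have : Continuous fun p : 𝔻 × ℝ => UnitDisc.mk (circleMap 0 (1 / 2) p.2) (hlt p.2) := by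
      rw [UnitDisc.isEmbedding_coe.continuous_iff]
      exact hcm
    exact hc.comp (continuous_fst.prodMk this)
  have hint : Continuous fun z : 𝔻 => ∫ θ in (0 : ℝ)..(2 * Real.pi),
      deriv (circleMap 0 (1 / 2)) θ • ((1 / circleMap 0 (1 / 2) θ) ^ n •
        (circleMap 0 (1 / 2) θ)⁻¹ • h z (circleMap 0 (1 / 2) θ)) := by
    refine intervalIntegral.continuous_parametric_intervalIntegral_of_continuous' ?_ _ _
    simp only [Function.uncurry_def, deriv_circleMap]
    exact (hcm.mul continuous_const).smul
      (((continuous_const.div hcm fun p => hne p.2).pow n).smul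
        ((hcm.inv₀ fun p => hne p.2).smul hD))
  exact continuous_const.mul hint

theorem measurable_sqSeries {h : 𝔻 → ℂ → ℂ}
    (hh : ∀ z, DifferentiableOn ℂ (h z) (Metric.ball 0 1))
    (hc : Continuous fun p : 𝔻 × 𝔻 => h p.1 p.2) (r : ℝ) :
    Measurable fun z => sqSeries (h z) r :=
  Measurable.tsum fun n =>
    ((continuous_coeffAtZero hh hc n).enorm.measurable.pow_const 2).mul_const _

theorem sqSeries_one_eq_iSup (h : ℂ → ℂ) :
    sqSeries h 1 = ⨆ n : ℕ, sqSeries h (1 - 1 / ((n : ℝ) + 1)) := by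
  have hmono : ∀ m n : ℕ, m ≤ n → 1 - 1 / ((m : ℝ) + 1) ≤ 1 - 1 / ((n : ℝ) + 1) :=
    fun m n hmn => by gcongr
  have hlim : Filter.Tendsto (fun n : ℕ => 1 - 1 / ((n : ℝ) + 1)) Filter.atTop (nhds 1) := by
    simpa using (tendsto_one_div_add_atTop_nhds_zero_nat (𝕜 := ℝ)).const_sub 1
  refine le_antisymm ?_ (iSup_le fun n => sqSeries_mono h ?_)
  -- Each finite partial sum is continuous in r, so its value at 1 is a limit of values bounded by
  -- the supremum.
  · rw [sqSeries, ENNReal.tsum_eq_iSup_sum]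
    refine iSup_le fun s => ?_
    have ht : Filter.Tendsto (fun n : ℕ => ∑ i ∈ s, ‖coeffAtZero h i‖ₑ ^ 2
        * ENNReal.ofReal (1 - 1 / ((n : ℝ) + 1)) ^ (2 * i)) Filter.atTop
        (nhds (∑ i ∈ s, ‖coeffAtZero h i‖ₑ ^ 2 * ENNReal.ofReal 1 ^ (2 * i))) := by
      refine tendsto_finsetSum _ fun i _ => ENNReal.Tendsto.const_mul ?_ (Or.inr (by simp))
      exact ((ENNReal.continuous_pow _).tendsto _).comp
        ((ENNReal.continuous_ofReal.tendsto _).comp hlim)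
    refine le_of_tendsto ht (Filter.Eventually.of_forall fun n => ?_)
    exact (ENNReal.sum_le_tsum s).trans
      (le_iSup (fun n : ℕ => sqSeries h (1 - 1 / ((n : ℝ) + 1))) n)
  · linarith [Nat.one_div_pos_of_nat (α := ℝ) (n := n)]

/-! ### Rigidity of invariant holomorphic functions on the bidisc -/

/-- A holomorphic function on the bidisc that is invariant under the diagonal action of `Γ`. -/
structure IsInvariantHolomorphic (Γ : Subgroup (Equiv.Perm 𝔻)) (F : ℂ × ℂ → ℂ) : Prop where
  differentiableOn : DifferentiableOn ℂ F (Metric.ball 0 1 ×ˢ Metric.ball 0 1)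
  invariant : ∀ γ ∈ Γ, ∀ z w : 𝔻, F (γ z, γ w) = F (z, w)

/-- The second variable of `F` in the coordinate centred at the first one. -/
noncomputable def fiberMap (F : ℂ × ℂ → ℂ) (z : ℂ) : ℂ → ℂ := recenter (fun w => F (z, w)) z

/-- The mean over a fundamental domain of the squared `L²` norms of `F` on the fibre circles of
radius `r`. -/
noncomputable def fiberMean (Γ : Subgroup (Equiv.Perm 𝔻)) (F : ℂ × ℂ → ℂ) (r : ℝ) : ℝ≥0∞ :=
  ∫⁻ z : 𝔻, dirichletWeight Γ z * sqSeries (fiberMap F z) r ∂hypMeasure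

/-- The integral of `‖F‖²` over the quotient of the bidisc, with the invariant density
`κ (pseudoDist z w)`. -/
noncomputable def kernelEnergy (Γ : Subgroup (Equiv.Perm 𝔻)) (F : ℂ × ℂ → ℂ) (κ : ℝ → ℝ≥0∞) :
    ℝ≥0∞ :=
  ∫⁻ z : 𝔻, dirichletWeight Γ z *
    ∫⁻ w : 𝔻, κ (pseudoDist z w) * ‖F (z, w)‖ₑ ^ 2 ∂hypMeasure ∂hypMeasure

/-- The mean variation of `F` in its first variable. -/
noncomputable def kernelVariation (Γ : Subgroup (Equiv.Perm 𝔻)) (F : ℂ × ℂ → ℂ)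
    (κ₁ κ₂ : ℝ → ℝ≥0∞) : ℝ≥0∞ :=
  ∫⁻ z : 𝔻, dirichletWeight Γ z * ∫⁻ a : 𝔻, κ₁ (pseudoDist z a) *
    ∫⁻ w : 𝔻, κ₂ (pseudoDist z w) * ‖F (a, w) - F (z, w)‖ₑ ^ 2
      ∂hypMeasure ∂hypMeasure ∂hypMeasure

namespace IsInvariantHolomorphic

variable {Γ : Subgroup (Equiv.Perm 𝔻)} {F : ℂ × ℂ → ℂ} (hF : IsInvariantHolomorphic Γ F)

include hF in
theorem continuous : Continuous fun p : 𝔻 × 𝔻 => F (p.1, p.2) :=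
  hF.differentiableOn.continuousOn.comp_continuous
    ((UnitDisc.continuous_coe.comp continuous_fst).prodMk
      (UnitDisc.continuous_coe.comp continuous_snd)) fun p =>
    ⟨mem_ball_zero_iff.mpr p.1.norm_lt_one, mem_ball_zero_iff.mpr p.2.norm_lt_one⟩

include hF in
theorem differentiableOn_right (z : 𝔻) :
    DifferentiableOn ℂ (fun w => F (z, w)) (Metric.ball 0 1) :=
  hF.differentiableOn.comp (by fun_prop) fun w hw =>
    ⟨mem_ball_zero_iff.mpr z.norm_lt_one, hw⟩

include hF in
theorem differentiableOn_left (w : 𝔻) :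
    DifferentiableOn ℂ (fun z => F (z, w)) (Metric.ball 0 1) :=
  hF.differentiableOn.comp (by fun_prop) fun z hz =>
    ⟨hz, mem_ball_zero_iff.mpr w.norm_lt_one⟩

include hF in
theorem differentiableOn_fiberMap (z : 𝔻) :
    DifferentiableOn ℂ (fiberMap F z) (Metric.ball 0 1) :=
  differentiableOn_recenter (hF.differentiableOn_right z) z

include hF in
theorem continuous_fiberMap : Continuous fun p : 𝔻 × 𝔻 => fiberMap F p.1 p.2 :=
  hF.continuous.comp (continuous_fst.prodMk continuous_diskMove)

include hF in
theorem measurable_sqSeries_fiberMap (r : ℝ) :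
    Measurable fun z : 𝔻 => sqSeries (fiberMap F z) r :=
  measurable_sqSeries hF.differentiableOn_fiberMap hF.continuous_fiberMap r

include hF in
theorem kernelMass_mul_fiberMean_le {κ : ℝ → ℝ≥0∞} (hκ : Measurable κ) (hfin : kernelMass κ ≠ ⊤)
    {r : ℝ} (hr : ∀ x < r, κ x = 0) : kernelMass κ * fiberMean Γ F r ≤ kernelEnergy Γ F κ := by
  rw [fiberMean, ← lintegral_const_mul' _ _ hfin]
  refine lintegral_mono fun z => ?_
  rw [mul_left_comm]
  exact mul_le_mul_right (kernelMass_mul_sqSeries_le hκ hr z (hF.differentiableOn_right z)) _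

include hF in
-- For fixed a and z the difference F(a, ·) - F(z, ·) is holomorphic, so its mean square over
-- circles about z grows with the radius: the variation per unit mass seen by κ₂ inside radius r is
-- at most that seen by κ₃ outside.
theorem kernelMass_mul_kernelVariation_le {κ₁ κ₂ κ₃ : ℝ → ℝ≥0∞}
    (hκ₂ : Measurable κ₂) (hκ₃ : Measurable κ₃) (hfin₂ : kernelMass κ₂ ≠ ⊤)
    (hfin₃ : kernelMass κ₃ ≠ ⊤) {r : ℝ} (h₂ : ∀ x > r, κ₂ x = 0) (h₃ : ∀ x < r, κ₃ x = 0) :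
    kernelMass κ₃ * kernelVariation Γ F κ₁ κ₂ ≤ kernelMass κ₂ * kernelVariation Γ F κ₁ κ₃ := by
  rw [kernelVariation, kernelVariation, ← lintegral_const_mul' _ _ hfin₃,
    ← lintegral_const_mul' _ _ hfin₂]
  refine lintegral_mono fun z => ?_
  rw [mul_left_comm, mul_left_comm (kernelMass κ₂)]
  refine mul_le_mul_right ?_ _
  rw [← lintegral_const_mul' _ _ hfin₃, ← lintegral_const_mul' _ _ hfin₂]
  refine lintegral_mono fun a => ?_
  rw [mul_left_comm, mul_left_comm (kernelMass κ₂)]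
  refine mul_le_mul_right ?_ _
  have hd : DifferentiableOn ℂ (fun w => F (a, w) - F (z, w)) (Metric.ball 0 1) :=
    (hF.differentiableOn_right a).sub (hF.differentiableOn_right z)
  refine (mul_le_mul_right (le_kernelMass_mul_sqSeries hκ₂ h₂ z hd) _).trans ?_
  rw [mul_left_comm]
  exact mul_le_mul_right (kernelMass_mul_sqSeries_le hκ₃ h₃ z hd) _

include hF in
theorem measurable_enorm_sq : Measurable fun p : 𝔻 × 𝔻 => ‖F (p.1, p.2)‖ₑ ^ 2 :=
  hF.continuous.enorm.measurable.pow_const 2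

include hF in
theorem measurable_enorm_sq_right (z : 𝔻) : Measurable fun w : 𝔻 => ‖F (z, w)‖ₑ ^ 2 :=
  (continuous_coe_of_differentiableOn (hF.differentiableOn_right z)).enorm.measurable.pow_const 2

include hF in
theorem measurable_lintegral_kernel_mul {κ : ℝ → ℝ≥0∞} (hκ : Measurable κ) :
    Measurable fun p : 𝔻 × 𝔻 =>
      ∫⁻ w : 𝔻, κ (pseudoDist p.1 w) * ‖F (p.2, w)‖ₑ ^ 2 ∂hypMeasure := by
  refine Measurable.lintegral_prod_right' (f := fun p : (𝔻 × 𝔻) × 𝔻 =>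
    κ (pseudoDist p.1.1 p.2) * ‖F (p.1.2, p.2)‖ₑ ^ 2) ?_
  refine Measurable.mul ?_ ?_
  · exact (measurable_kernel hκ).comp ((measurable_fst.comp measurable_fst).prodMk measurable_snd)
  · exact hF.measurable_enorm_sq.comp
      ((measurable_snd.comp measurable_fst).prodMk measurable_snd)

include hF in
-- Since |F(a, w)| does not involve z, moving the fundamental domain from z to a leaves a free
-- integral over z of the two kernels alone.
theorem lintegral_kernel_unfold (hΓ : IsCocompactFreeFuchsian Γ) {κ₁ κ₂ : ℝ → ℝ≥0∞}
    (hκ₁ : Measurable κ₁) (hκ₂ : Measurable κ₂) :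
    ∫⁻ z : 𝔻, dirichletWeight Γ z * ∫⁻ a : 𝔻, κ₁ (pseudoDist z a) *
        ∫⁻ w : 𝔻, κ₂ (pseudoDist z w) * ‖F (a, w)‖ₑ ^ 2 ∂hypMeasure ∂hypMeasure ∂hypMeasure
      = ∫⁻ a : 𝔻, dirichletWeight Γ a * ∫⁻ w : 𝔻, kernelComp κ₁ κ₂ a w * ‖F (a, w)‖ₑ ^ 2
          ∂hypMeasure ∂hypMeasure := by
  rw [hΓ.lintegral_unfold (H := fun z a => κ₁ (pseudoDist z a) *
      ∫⁻ w : 𝔻, κ₂ (pseudoDist z w) * ‖F (a, w)‖ₑ ^ 2 ∂hypMeasure)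
    ((measurable_kernel hκ₁).mul (hF.measurable_lintegral_kernel_mul hκ₂))]
  · refine lintegral_congr fun a => ?_
    rw [lintegral_kernelComp_mul hκ₁ hκ₂ a (hF.measurable_enorm_sq_right a)]
  · intro γ hγ z a
    have hγ' := hΓ.le_PSU11 hγ
    rw [pseudoDist_smul hγ', ← lintegral_comp_PSU11 hγ'
      (H := fun w => κ₂ (pseudoDist (γ z) w) * ‖F (γ a, w)‖ₑ ^ 2)
      ((measurable_kernel_right hκ₂ _).mul (hF.measurable_enorm_sq_right _))]
    simp only [pseudoDist_smul hγ', hF.invariant γ hγ]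

include hF in
/-- The mean value property of `F` in its first variable, averaged over the second one. -/
theorem lintegral_kernel_variation {κ₁ κ₂ : ℝ → ℝ≥0∞} (hκ₁ : Measurable κ₁)
    (hκ₂ : Measurable κ₂) (z : 𝔻) :
    ∫⁻ a : 𝔻, κ₁ (pseudoDist z a) * ∫⁻ w : 𝔻, κ₂ (pseudoDist z w) *
        ‖F (a, w) - F (z, w)‖ₑ ^ 2 ∂hypMeasure ∂hypMeasure
      + kernelMass κ₁ * ∫⁻ w : 𝔻, κ₂ (pseudoDist z w) * ‖F (z, w)‖ₑ ^ 2 ∂hypMeasure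
      = ∫⁻ a : 𝔻, κ₁ (pseudoDist z a) *
          ∫⁻ w : 𝔻, κ₂ (pseudoDist z w) * ‖F (a, w)‖ₑ ^ 2 ∂hypMeasure ∂hypMeasure := by
  have hm : Measurable fun w : 𝔻 => κ₂ (pseudoDist z w) * ‖F (z, w)‖ₑ ^ 2 :=
    (measurable_kernel_right hκ₂ z).mul (hF.measurable_enorm_sq_right z)
  have hd : Measurable fun p : 𝔻 × 𝔻 => ‖F (p.1, p.2) - F (z, p.2)‖ₑ ^ 2 := by
    refine Measurable.pow_const (Continuous.measurable (Continuous.enorm ?_)) 2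
    exact hF.continuous.sub ((continuous_coe_of_differentiableOn
      (hF.differentiableOn_right z)).comp continuous_snd)
  rw [lintegral_kernel_swap hκ₁ hκ₂ z (u := fun a w => ‖F (a, w) - F (z, w)‖ₑ ^ 2) hd,
    lintegral_kernel_swap hκ₁ hκ₂ z (u := fun a w => ‖F (a, w)‖ₑ ^ 2) hF.measurable_enorm_sq,
    ← lintegral_const_mul _ hm, ← lintegral_add_right _ (hm.const_mul _)]
  refine lintegral_congr fun w => ?_
  rw [← lintegral_kernel_mul_enorm_sub_sq hκ₁ z (hF.differentiableOn_left w)]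
  ring

include hF in
theorem kernelVariation_add (hΓ : IsCocompactFreeFuchsian Γ) {κ₁ κ₂ : ℝ → ℝ≥0∞}
    (hκ₁ : Measurable κ₁) (hκ₂ : Measurable κ₂) :
    kernelVariation Γ F κ₁ κ₂ + kernelMass κ₁ * kernelEnergy Γ F κ₂
      = ∫⁻ a : 𝔻, dirichletWeight Γ a * ∫⁻ w : 𝔻, kernelComp κ₁ κ₂ a w * ‖F (a, w)‖ₑ ^ 2
          ∂hypMeasure ∂hypMeasure := by
  have hm : Measurable fun z : 𝔻 => dirichletWeight Γ z *
      ∫⁻ w : 𝔻, κ₂ (pseudoDist z w) * ‖F (z, w)‖ₑ ^ 2 ∂hypMeasure :=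
    hΓ.measurable_dirichletWeight.mul
      ((hF.measurable_lintegral_kernel_mul hκ₂).comp (measurable_id.prodMk measurable_id))
  rw [← hF.lintegral_kernel_unfold hΓ hκ₁ hκ₂, kernelVariation, kernelEnergy,
    ← lintegral_const_mul _ hm, ← lintegral_add_right _ (hm.const_mul _)]
  refine lintegral_congr fun z => ?_
  rw [mul_left_comm, ← mul_add, hF.lintegral_kernel_variation hκ₁ hκ₂]

include hF in
-- Recentred at a, the composed kernel is rotation invariant, so |F|² may be replaced by its circle
-- means, each at most `sqSeries` at radius 1.
theorem lintegral_kernelComp_mul_le {κ₁ κ₂ : ℝ → ℝ≥0∞} (hκ₁ : Measurable κ₁)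
    (hκ₂ : Measurable κ₂) (a : 𝔻) :
    ∫⁻ w : 𝔻, kernelComp κ₁ κ₂ a w * ‖F (a, w)‖ₑ ^ 2 ∂hypMeasure
      ≤ kernelMass κ₁ * kernelMass κ₂ * sqSeries (fiberMap F a) 1 := by
  have hq0 := measurable_kernelComp_right hκ₁ hκ₂ 0
  calc ∫⁻ w : 𝔻, kernelComp κ₁ κ₂ a w * ‖F (a, w)‖ₑ ^ 2 ∂hypMeasure
      = ∫⁻ t : 𝔻, kernelComp κ₁ κ₂ 0 t * ‖fiberMap F a t‖ₑ ^ 2 ∂hypMeasure := by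
        rw [← lintegral_comp_PSU11 (diskMove_mem a)
          (H := fun w : 𝔻 => kernelComp κ₁ κ₂ a w * ‖F (a, w)‖ₑ ^ 2)
          ((measurable_kernelComp_right hκ₁ hκ₂ a).mul (hF.measurable_enorm_sq_right a))]
        refine lintegral_congr fun t => ?_
        rw [← kernelComp_smul hκ₁ hκ₂ (diskMove_mem a) 0 t, diskMove_zero_right]
        rfl
    _ = ∫⁻ t : 𝔻, kernelComp κ₁ κ₂ 0 t * sqSeries (fiberMap F a) ‖(t : ℂ)‖ ∂hypMeasure := by
        refine lintegral_mul_enorm_sq hq0 (fun c t => ?_) (hF.differentiableOn_fiberMap a)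
        have := kernelComp_smul hκ₁ hκ₂ (circle_toPerm_mem c) 0 t
        rwa [MulAction.toPerm_apply, MulAction.toPerm_apply,
          show c • (0 : 𝔻) = 0 by rw [← UnitDisc.coe_inj]; simp] at this
    _ ≤ ∫⁻ t : 𝔻, kernelComp κ₁ κ₂ 0 t * sqSeries (fiberMap F a) 1 ∂hypMeasure :=
        lintegral_mono fun t => mul_le_mul_right (sqSeries_mono _ t.norm_lt_one.le) _
    _ = kernelMass κ₁ * kernelMass κ₂ * sqSeries (fiberMap F a) 1 := by
        rw [lintegral_mul_const _ hq0, lintegral_kernelComp hκ₁ hκ₂]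

include hF in
theorem kernelVariation_add_le (hΓ : IsCocompactFreeFuchsian Γ) {κ₁ κ₂ : ℝ → ℝ≥0∞}
    (hκ₁ : Measurable κ₁) (hκ₂ : Measurable κ₂) (hfin₁ : kernelMass κ₁ ≠ ⊤)
    (hfin₂ : kernelMass κ₂ ≠ ⊤) :
    kernelVariation Γ F κ₁ κ₂ + kernelMass κ₁ * kernelEnergy Γ F κ₂
      ≤ kernelMass κ₁ * kernelMass κ₂ * fiberMean Γ F 1 := by
  rw [hF.kernelVariation_add hΓ hκ₁ hκ₂, fiberMean,
    ← lintegral_const_mul' _ _ (ENNReal.mul_ne_top hfin₁ hfin₂)]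
  refine lintegral_mono fun a => ?_
  rw [mul_left_comm]
  exact mul_le_mul_right (hF.lintegral_kernelComp_mul_le hκ₁ hκ₂ a) _

include hF in
theorem fiberMean_one_eq_iSup (hΓ : IsCocompactFreeFuchsian Γ) :
    fiberMean Γ F 1 = ⨆ n : ℕ, fiberMean Γ F (1 - 1 / ((n : ℝ) + 1)) := by
  simp only [fiberMean, sqSeries_one_eq_iSup, ENNReal.mul_iSup]
  refine lintegral_iSup (fun n =>
    hΓ.measurable_dirichletWeight.mul (hF.measurable_sqSeries_fiberMap _)) fun m n hmn z => ?_
  refine mul_le_mul_right (sqSeries_mono _ ?_) _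
  gcongr

end IsInvariantHolomorphic

/-! ### Vanishing of the variation -/

/-- An invariant density concentrated on the pairs at pseudo-hyperbolic distance less than
`1 / 2`. -/
noncomputable def innerWeight (x : ℝ) : ℝ≥0∞ := ENNReal.ofReal (1 / 2 - x)

/-- An invariant density concentrated on the pairs at pseudo-hyperbolic distance at least `r`. -/
noncomputable def outerWeight (r x : ℝ) : ℝ≥0∞ := if x < r then 0 else discWeight x

theorem continuous_innerWeight : Continuous innerWeight := by
  unfold innerWeight
  exact ENNReal.continuous_ofReal.comp (by fun_prop)

theorem measurable_outerWeight (r : ℝ) : Measurable (outerWeight r) :=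
  Measurable.ite measurableSet_Iio measurable_const continuous_discWeight.measurable

theorem discWeight_ne_zero {x : ℝ} (h0 : 0 ≤ x) (h1 : x < 1) : discWeight x ≠ 0 := by
  rw [discWeight, Ne, ENNReal.ofReal_eq_zero, not_le]
  have : 0 < 1 - x ^ 2 := by nlinarith
  positivity

theorem kernelMass_discWeight_ne_top : kernelMass discWeight ≠ ⊤ := lintegral_discWeight_lt_top.ne

theorem kernelMass_innerWeight_ne_top : kernelMass innerWeight ≠ ⊤ := by
  refine ne_top_of_le_ne_top kernelMass_discWeight_ne_top (lintegral_mono fun t => ?_)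
  refine ENNReal.ofReal_le_ofReal ?_
  have := norm_nonneg (t : ℂ)
  -- For 0 ≤ x ≤ 1/2 one has (1 - x²)² ≥ 1 - 2x² ≥ 1 - x; for x > 1/2 the left side is negative.
  rcases le_or_gt ‖(t : ℂ)‖ (1 / 2) with h | h
  · nlinarith [sq_nonneg ‖(t : ℂ)‖, mul_nonneg this (sub_nonneg.mpr h)]
  · nlinarith [sq_nonneg (1 - ‖(t : ℂ)‖ ^ 2)]

theorem kernelMass_outerWeight_ne_top (r : ℝ) : kernelMass (outerWeight r) ≠ ⊤ := by
  refine ne_top_of_le_ne_top kernelMass_discWeight_ne_top (lintegral_mono fun t => ?_)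
  dsimp only [outerWeight]
  split_ifs
  · exact zero_le
  · exact le_rfl

theorem kernelMass_outerWeight_ne_zero {r : ℝ} (hr : r < 1) : kernelMass (outerWeight r) ≠ 0 := by
  intro h
  rw [kernelMass, lintegral_eq_zero_iff (measurable_kernel_norm (measurable_outerWeight r))] at h
  have hU : IsOpen {t : 𝔻 | r < ‖(t : ℂ)‖} :=
    isOpen_lt continuous_const UnitDisc.continuous_coe.norm
  have hne : {t : 𝔻 | r < ‖(t : ℂ)‖}.Nonempty := by
    obtain ⟨x, hx, hx1⟩ := exists_between (max_lt hr one_pos)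
    have hx0 : 0 ≤ x := (le_max_right _ _).trans hx.le
    have hn : ‖(x : ℂ)‖ = x := by rw [Complex.norm_real, Real.norm_of_nonneg hx0]
    refine ⟨UnitDisc.mk x (by rwa [hn]), ?_⟩
    change r < ‖(x : ℂ)‖
    rw [hn]
    exact (le_max_left _ _).trans_lt hx
  refine hU.measure_ne_zero hypMeasure hne (measure_mono_null (fun t ht => ?_) h)
  change ¬ outerWeight r ‖(t : ℂ)‖ = 0
  rw [outerWeight, if_neg (not_lt.mpr (le_of_lt ht))]
  exact discWeight_ne_zero (norm_nonneg _) t.norm_lt_one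

/-- Countably many preimages of the same measure cover the disc. -/
theorem hypMeasure_dirichletSet_ne_zero {Γ : Subgroup (Equiv.Perm 𝔻)}
    (hΓ : IsCocompactFreeFuchsian Γ) : hypMeasure (dirichletSet Γ) ≠ 0 := by
  intro h
  have := hΓ.countable
  have hcov : (Set.univ : Set 𝔻) ⊆ ⋃ γ : Γ, (γ : Equiv.Perm 𝔻) ⁻¹' dirichletSet Γ := fun z _ => by
    obtain ⟨γ, hγ, hz⟩ := hΓ.exists_mem_dirichletSet z
    exact Set.mem_iUnion.mpr ⟨⟨γ, hγ⟩, hz⟩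
  have hnull : hypMeasure (⋃ γ : Γ, (γ : Equiv.Perm 𝔻) ⁻¹' dirichletSet Γ) = 0 :=
    measure_iUnion_null fun γ => by
      rw [(measurePreserving_of_mem_PSU11 (hΓ.le_PSU11 γ.2)).measure_preimage
        hΓ.measurableSet_dirichletSet.nullMeasurableSet, h]
  exact isOpen_univ.measure_ne_zero hypMeasure ⟨0, trivial⟩ (measure_mono_null hcov hnull)

theorem exists_ae_eq_zero_of_lintegral {Γ : Subgroup (Equiv.Perm 𝔻)}
    (hΓ : IsCocompactFreeFuchsian Γ) {κ : ℝ → ℝ≥0∞} (hκ : Measurable κ)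
    (hpos : ∀ x, 0 ≤ x → x < 1 → κ x ≠ 0) {J : 𝔻 → 𝔻 → ℝ≥0∞}
    (hJ : Measurable fun p : 𝔻 × 𝔻 => J p.1 p.2)
    (h0 : ∫⁻ z, dirichletWeight Γ z *
      ∫⁻ a, κ (pseudoDist z a) * J z a ∂hypMeasure ∂hypMeasure = 0) :
    ∃ z, ∀ᵐ a ∂hypMeasure, J z a = 0 := by
  have hm : Measurable fun p : 𝔻 × 𝔻 => κ (pseudoDist p.1 p.2) * J p.1 p.2 :=
    (measurable_kernel hκ).mul hJ
  have hmz : Measurable fun z : 𝔻 => dirichletWeight Γ z *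
      ∫⁻ a, κ (pseudoDist z a) * J z a ∂hypMeasure :=
    hΓ.measurable_dirichletWeight.mul hm.lintegral_prod_right'
  rw [lintegral_eq_zero_iff hmz] at h0
  obtain ⟨z, hz, hz0⟩ : ∃ z ∈ dirichletSet Γ, dirichletWeight Γ z *
      ∫⁻ a, κ (pseudoDist z a) * J z a ∂hypMeasure = 0 := by
    by_contra! hcon
    exact hypMeasure_dirichletSet_ne_zero hΓ (measure_mono_null (fun z hz => hcon z hz) h0)
  have hz1 := (mul_eq_zero.mp hz0).resolve_left (hΓ.dirichletWeight_ne_zero hz)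
  have hma : Measurable fun a : 𝔻 => κ (pseudoDist z a) * J z a :=
    hm.comp measurable_prodMk_left
  rw [lintegral_eq_zero_iff hma] at hz1
  refine ⟨z, hz1.mono fun a ha => (mul_eq_zero.mp ha).resolve_left (hpos _ ?_ ?_)⟩
  · rw [pseudoDist]
    exact norm_nonneg _
  · exact pseudoDist_lt_one z a

namespace IsInvariantHolomorphic

variable {Γ : Subgroup (Equiv.Perm 𝔻)} {F : ℂ × ℂ → ℂ} (hF : IsInvariantHolomorphic Γ F)

theorem fiberMean_mono : Monotone (fiberMean Γ F) := fun _ _ hrs =>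
  lintegral_mono fun _ => mul_le_mul_right (sqSeries_mono _ hrs) _

include hF in
theorem kernelVariation_innerWeight_add_le (hΓ : IsCocompactFreeFuchsian Γ) {r : ℝ} (hr : r < 1) :
    kernelVariation Γ F discWeight innerWeight
        + kernelMass innerWeight * kernelMass discWeight * fiberMean Γ F r
      ≤ kernelMass innerWeight * kernelMass discWeight * fiberMean Γ F 1 := by
  -- From radius 1/2 on, `innerWeight` vanishes beyond r; for smaller r the claim is weaker because
  -- M is monotone.
  wlog h : 1 / 2 ≤ r generalizing r
  · refine le_trans ?_ (this (r := 1 / 2) (by norm_num) le_rfl)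
    gcongr
    exact fiberMean_mono (not_le.mp h).le
  have hd := continuous_discWeight.measurable
  have ho := measurable_outerWeight r
  have h1 := hF.kernelMass_mul_kernelVariation_le (κ₁ := discWeight) (r := r)
    continuous_innerWeight.measurable ho kernelMass_innerWeight_ne_top
    (kernelMass_outerWeight_ne_top r)
    (fun x hx => by
      rw [innerWeight, ENNReal.ofReal_eq_zero]; linarith [h.trans_lt hx])
    (fun x hx => if_pos hx)
  have h2 := hF.kernelVariation_add_le hΓ hd ho kernelMass_discWeight_ne_top
    (kernelMass_outerWeight_ne_top r)
  have h3 := hF.kernelMass_mul_fiberMean_le ho (kernelMass_outerWeight_ne_top r)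
    (r := r) fun x hx => if_pos hx
  set m := kernelMass (outerWeight r)
  set m₁ := kernelMass innerWeight
  set m₂ := kernelMass discWeight
  -- Multiplying by the finite nonzero mass of the outer weight replaces the division by m₂ in the
  -- comparison of variations.
  rw [← ENNReal.mul_le_mul_iff_right (kernelMass_outerWeight_ne_zero hr)
    (kernelMass_outerWeight_ne_top r)]
  calc m * (kernelVariation Γ F discWeight innerWeight + m₁ * m₂ * fiberMean Γ F r)
      = m * kernelVariation Γ F discWeight innerWeight
        + m₁ * (m₂ * (m * fiberMean Γ F r)) := by ring
    _ ≤ m₁ * kernelVariation Γ F discWeight (outerWeight r)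
        + m₁ * (m₂ * kernelEnergy Γ F (outerWeight r)) := by gcongr
    _ ≤ m₁ * (m₂ * m * fiberMean Γ F 1) := by
        rw [← mul_add]
        gcongr
    _ = m * (m₁ * m₂ * fiberMean Γ F 1) := by ring

include hF in
theorem kernelVariation_eq_zero (hΓ : IsCocompactFreeFuchsian Γ) (hfin : fiberMean Γ F 1 ≠ ⊤) :
    kernelVariation Γ F discWeight innerWeight = 0 := by
  have h : kernelVariation Γ F discWeight innerWeight
      + kernelMass innerWeight * kernelMass discWeight * fiberMean Γ F 1
      ≤ 0 + kernelMass innerWeight * kernelMass discWeight * fiberMean Γ F 1 := by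
    rw [zero_add]
    -- Passing to the supremum over r < 1 on the left only; M(1) is finite, so the common term then
    -- cancels.
    nth_rewrite 1 [hF.fiberMean_one_eq_iSup hΓ]
    rw [ENNReal.mul_iSup, ENNReal.add_iSup]
    refine iSup_le fun n => hF.kernelVariation_innerWeight_add_le hΓ ?_
    linarith [Nat.one_div_pos_of_nat (α := ℝ) (n := n)]
  refine le_antisymm (ENNReal.le_of_add_le_add_right ?_ h) zero_le
  exact ENNReal.mul_ne_top
    (ENNReal.mul_ne_top kernelMass_innerWeight_ne_top kernelMass_discWeight_ne_top) hfin

include hF in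
theorem measurable_lintegral_kernel_mul_sub {κ : ℝ → ℝ≥0∞} (hκ : Measurable κ) :
    Measurable fun p : 𝔻 × 𝔻 =>
      ∫⁻ w : 𝔻, κ (pseudoDist p.1 w) * ‖F (p.2, w) - F (p.1, w)‖ₑ ^ 2 ∂hypMeasure := by
  refine Measurable.lintegral_prod_right' (f := fun p : (𝔻 × 𝔻) × 𝔻 =>
    κ (pseudoDist p.1.1 p.2) * ‖F (p.1.2, p.2) - F (p.1.1, p.2)‖ₑ ^ 2) ?_
  refine Measurable.mul ?_ (Measurable.pow_const (Continuous.measurable (Continuous.enorm ?_)) 2)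
  · exact (measurable_kernel hκ).comp ((measurable_fst.comp measurable_fst).prodMk measurable_snd)
  · exact (hF.continuous.comp ((continuous_snd.comp continuous_fst).prodMk continuous_snd)).sub
      (hF.continuous.comp ((continuous_fst.comp continuous_fst).prodMk continuous_snd))

include hF in
-- A vanishing integral gives one z and almost every a. Continuity in w upgrades this to every w
-- near z, since a nonempty open set has positive measure; continuity in a then removes the
-- remaining exceptional set.
theorem exists_eq_of_pseudoDist_lt (hΓ : IsCocompactFreeFuchsian Γ)
    (hfin : fiberMean Γ F 1 ≠ ⊤) :
    ∃ z : 𝔻, ∀ a w : 𝔻, pseudoDist z w < 1 / 2 → F (a, w) = F (z, w) := by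
  obtain ⟨z, hz⟩ := exists_ae_eq_zero_of_lintegral hΓ
    continuous_discWeight.measurable (fun _ => discWeight_ne_zero) (J := fun z a =>
      ∫⁻ w : 𝔻, innerWeight (pseudoDist z w) * ‖F (a, w) - F (z, w)‖ₑ ^ 2 ∂hypMeasure)
    (hF.measurable_lintegral_kernel_mul_sub continuous_innerWeight.measurable)
    (hF.kernelVariation_eq_zero hΓ hfin)
  have hae : ∀ᵐ a : 𝔻 ∂hypMeasure, ∀ w : 𝔻, pseudoDist z w < 1 / 2 → F (a, w) = F (z, w) := by
    filter_upwards [hz] with a hi w hw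
    have hcd : Continuous fun w : 𝔻 => ‖F (a, w) - F (z, w)‖ₑ ^ 2 :=
      (ENNReal.continuous_pow 2).comp
        ((continuous_coe_of_differentiableOn (hF.differentiableOn_right a)).sub
          (continuous_coe_of_differentiableOn (hF.differentiableOn_right z))).enorm
    have hU : IsOpen {w : 𝔻 | pseudoDist z w < 1 / 2} := isOpen_lt
      (continuous_pseudoDist.comp (Continuous.prodMk_right z)) continuous_const
    have hck : Measurable fun w : 𝔻 => innerWeight (pseudoDist z w) :=
      measurable_kernel_right continuous_innerWeight.measurable z
    have hm : Measurable fun w : 𝔻 =>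
        innerWeight (pseudoDist z w) * ‖F (a, w) - F (z, w)‖ₑ ^ 2 := hck.mul hcd.measurable
    rw [lintegral_eq_zero_iff hm] at hi
    have hV : IsOpen {w : 𝔻 | pseudoDist z w < 1 / 2 ∧ ‖F (a, w) - F (z, w)‖ₑ ^ 2 ≠ 0} :=
      hU.inter (isOpen_ne_fun hcd continuous_const)
    by_contra hne
    refine hV.measure_ne_zero hypMeasure ⟨w, hw, ?_⟩ (measure_mono_null (fun v hv => ?_) hi)
    · simpa [sub_eq_zero] using hne
    · refine mul_ne_zero ?_ hv.2
      rw [innerWeight, Ne, ENNReal.ofReal_eq_zero, not_le]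
      exact sub_pos.mpr hv.1
  refine ⟨z, fun a w hw => ?_⟩
  have hcl := continuous_coe_of_differentiableOn (hF.differentiableOn_left w)
  have := Measure.eq_of_ae_eq (μ := hypMeasure) (f := fun a : 𝔻 => F (a, w))
    (g := fun _ => F (z, w)) (hae.mono fun a ha => ha w hw) hcl continuous_const
  exact congrFun this a

include hF in
theorem exists_eq_left (hΓ : IsCocompactFreeFuchsian Γ) (hfin : fiberMean Γ F 1 ≠ ⊤) :
    ∃ z : 𝔻, ∀ a w : 𝔻, F (a, w) = F (z, w) := by
  obtain ⟨z, hz⟩ := hF.exists_eq_of_pseudoDist_lt hΓ hfin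
  refine ⟨z, fun a w => ?_⟩
  have hU : IsOpen {w : 𝔻 | pseudoDist z w < 1 / 2} := isOpen_lt
    (continuous_pseudoDist.comp (Continuous.prodMk_right z)) continuous_const
  have hzU : ∀ᶠ w in nhds z, pseudoDist z w < 1 / 2 := by
    refine hU.mem_nhds ?_
    change pseudoDist z z < 1 / 2
    rw [pseudoDist]
    simp
  have hev : (fun w => F (a, w)) =ᶠ[nhds (z : ℂ)] fun w => F (z, w) := by
    rw [← UnitDisc.isOpenEmbedding_coe.map_nhds_eq, Filter.EventuallyEq, Filter.eventually_map]
    exact hzU.mono fun w hw => hz a w hw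
  exact ((hF.differentiableOn_right a).analyticOnNhd
    Metric.isOpen_ball).eqOn_of_preconnected_of_eventuallyEq
    ((hF.differentiableOn_right z).analyticOnNhd Metric.isOpen_ball)
    (convex_ball _ _).isPreconnected (mem_ball_zero_iff.mpr z.norm_lt_one) hev
    (mem_ball_zero_iff.mpr w.norm_lt_one)

include hF in
theorem exists_eq_const (hΓ : IsCocompactFreeFuchsian Γ) (hfin : fiberMean Γ F 1 ≠ ⊤) :
    ∃ c : ℂ, ∀ z w : 𝔻, F (z, w) = c := by
  obtain ⟨z, hz⟩ := hF.exists_eq_left hΓ hfin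
  obtain ⟨r, hr, hlt⟩ := hΓ.exists_norm_lt
  have hne : {w : 𝔻 | ‖(w : ℂ)‖ ≤ r}.Nonempty := by
    obtain ⟨γ, -, h⟩ := hlt 0
    exact ⟨γ 0, h.le⟩
  have hd := hF.differentiableOn_right z
  obtain ⟨v, -, hv⟩ := (isCompact_norm_le hr).exists_isMaxOn hne
    (continuous_coe_of_differentiableOn hd).norm.continuousOn
  have hmax : IsMaxOn (norm ∘ fun w => F (z, w)) (Metric.ball 0 1) (v : ℂ) := by
    intro w hw
    lift w to 𝔻 using mem_ball_zero_iff.mp hw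
    obtain ⟨γ, hγ, h⟩ := hlt w
    have hle : ‖F (z, γ w)‖ ≤ ‖F (z, v)‖ := hv h.le
    -- The first variable is immaterial, so it may be moved to γ z, which makes diagonal invariance
    -- apply to w alone.
    rw [← hz (γ z) (γ w), hF.invariant γ hγ] at hle
    exact hle
  refine ⟨F (z, v), fun a w => ?_⟩
  rw [hz a w]
  exact Complex.eqOn_of_isPreconnected_of_isMaxOn_norm (convex_ball _ _).isPreconnected
    Metric.isOpen_ball hd (mem_ball_zero_iff.mpr v.norm_lt_one) hmax
    (mem_ball_zero_iff.mpr w.norm_lt_one)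

include hF in
theorem fiberMean_one_ne_top_of_bounded (hΓ : IsCocompactFreeFuchsian Γ) {C : ℝ}
    (hC : ∀ z w : 𝔻, ‖F (z, w)‖ ≤ C) : fiberMean Γ F 1 ≠ ⊤ := by
  have hle : ∀ z : 𝔻, sqSeries (fiberMap F z) 1 ≤ ENNReal.ofReal C ^ 2 := by
    intro z
    rw [sqSeries_one_eq_iSup]
    refine iSup_le fun n => ?_
    set r : ℝ := 1 - 1 / ((n : ℝ) + 1) with hr
    have h1 : r < 1 := by linarith [Nat.one_div_pos_of_nat (α := ℝ) (n := n)]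
    have h0 : 0 ≤ r := by
      have : 1 / ((n : ℝ) + 1) ≤ 1 := by
        rw [div_le_one (by positivity)]
        linarith [Nat.cast_nonneg (α := ℝ) n]
      linarith
    have hn : ‖(r : ℂ)‖ = r := by rw [Complex.norm_real, Real.norm_of_nonneg h0]
    have h := lintegral_circle_enorm_sq (hF.differentiableOn_fiberMap z) (z := r) (by rwa [hn])
    rw [hn] at h
    rw [← h]
    refine (lintegral_mono (g := fun _ => ENNReal.ofReal C ^ 2) fun x => ?_).trans (by simp)
    have hx : ‖(AddCircle.toCircle x : ℂ) * r‖ < 1 := by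
      rwa [norm_mul, Circle.norm_coe, one_mul, hn]
    refine pow_le_pow_left' ?_ 2
    rw [← ofReal_norm]
    exact ENNReal.ofReal_le_ofReal (hC z (diskMove z (UnitDisc.mk _ hx)))
  have hlt : fiberMean Γ F 1 ≤ ∫⁻ z, dirichletWeight Γ z * ENNReal.ofReal C ^ 2 ∂hypMeasure :=
    lintegral_mono fun z => mul_le_mul_right (hle z) _
  refine ne_top_of_le_ne_top ?_ hlt
  rw [lintegral_mul_const _ hΓ.measurable_dirichletWeight]
  exact ENNReal.mul_ne_top hΓ.lintegral_dirichletWeight_lt_top.ne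
    (ENNReal.pow_ne_top ENNReal.ofReal_ne_top)

end IsInvariantHolomorphic

/-! ### Functions on the disc bundle -/

theorem bidiscLift_coe (Γ : Subgroup (Equiv.Perm 𝔻)) (f : DiscBundle Γ → ℂ) (z w : 𝔻) :
    bidiscLift Γ f (z, w) = f (Quotient.mk _ (z, w)) := by
  rw [bidiscLift, dif_pos ⟨z.norm_lt_one, w.norm_lt_one⟩]
  rfl

theorem IsHolomorphic.isInvariantHolomorphic {Γ : Subgroup (Equiv.Perm 𝔻)} {f : DiscBundle Γ → ℂ}
    (hf : IsHolomorphic Γ f) : IsInvariantHolomorphic Γ (bidiscLift Γ f) := by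
  refine ⟨hf, fun γ hγ z w => ?_⟩
  rw [bidiscLift_coe, bidiscLift_coe]
  congr 1
  exact Quotient.sound ⟨⟨γ, hγ⟩, rfl⟩

theorem exists_eq_const_of_bidiscLift {Γ : Subgroup (Equiv.Perm 𝔻)} {f : DiscBundle Γ → ℂ}
    (h : ∃ c : ℂ, ∀ z w : 𝔻, bidiscLift Γ f (z, w) = c) : ∃ c : ℂ, ∀ x, f x = c := by
  obtain ⟨c, hc⟩ := h
  refine ⟨c, fun x => ?_⟩
  induction x using Quotient.inductionOn with
  | h p => rw [← hc p.1 p.2, bidiscLift_coe]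

theorem enorm_associatedDifferential_sq (Γ : Subgroup (Equiv.Perm 𝔻)) (f : DiscBundle Γ → ℂ)
    (n : ℕ) {z : ℂ} (hz : ‖z‖ < 1) :
    ENNReal.ofReal (‖associatedDifferential Γ f n z‖ ^ 2 * (poincareCoeff z ^ n)⁻¹ *
        (2 * poincareCoeff z))
      = hypDensity z * ‖coeffAtZero (fiberMap (bidiscLift Γ f) z) n‖ₑ ^ 2 := by
  have hpos : 0 < 1 - ‖z‖ ^ 2 := by nlinarith [norm_nonneg z]
  have h : ‖associatedDifferential Γ f n z‖ ^ 2 * (poincareCoeff z ^ n)⁻¹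
      = ‖coeffAtZero (fiberMap (bidiscLift Γ f) z) n‖ ^ 2 := by
    -- The factor √2 / (1 - |z|²) is the square root of g, so the pointwise norm of φ_n is |f_n|.
    have h1 : (‖((√2 / (1 - ‖z‖ ^ 2) : ℝ) : ℂ) ^ n‖) ^ 2 = poincareCoeff z ^ n := by
      rw [norm_pow, Complex.norm_real, Real.norm_of_nonneg (by positivity), ← pow_mul,
        mul_comm, pow_mul, div_pow, Real.sq_sqrt (by norm_num)]
      rfl
    have h2 : poincareCoeff z ^ n ≠ 0 := by
      have : 0 < poincareCoeff z := by unfold poincareCoeff; positivity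
      positivity
    rw [associatedDifferential, norm_mul, mul_pow, h1, mul_assoc, mul_inv_cancel₀ h2, mul_one]
    rfl
  rw [h, ENNReal.ofReal_mul (by positivity), ENNReal.ofReal_pow (norm_nonneg _), ofReal_norm,
    mul_comm]
  rfl

theorem differentialNormSq_associatedDifferential {Γ : Subgroup (Equiv.Perm 𝔻)}
    (hΓ : IsCocompactFreeFuchsian Γ) (f : DiscBundle Γ → ℂ) (n : ℕ) :
    differentialNormSq Γ n (associatedDifferential Γ f n)
      = ∫⁻ z in dirichletSet Γ, ‖coeffAtZero (fiberMap (bidiscLift Γ f) z) n‖ₑ ^ 2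
          ∂hypMeasure := by
  have hsub : dirichletDomain Γ ⊆ Metric.ball 0 1 := fun z hz => mem_ball_zero_iff.mpr hz.1
  have hmeas : MeasurableSet (dirichletDomain Γ) := by
    rw [← image_dirichletSet]
    exact UnitDisc.measurableEmbedding_coe.measurableSet_image.mpr hΓ.measurableSet_dirichletSet
  rw [← lintegral_indicator hΓ.measurableSet_dirichletSet]
  have hind : ∀ z : 𝔻, (dirichletSet Γ).indicator
      (fun z : 𝔻 => ‖coeffAtZero (fiberMap (bidiscLift Γ f) z) n‖ₑ ^ 2) z
      = (dirichletDomain Γ).indicator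
        (fun z : ℂ => ‖coeffAtZero (fiberMap (bidiscLift Γ f) z) n‖ₑ ^ 2) z := by
    intro z
    have : (z : ℂ) ∈ dirichletDomain Γ ↔ z ∈ dirichletSet Γ := by
      rw [← image_dirichletSet, UnitDisc.coe_injective.mem_set_image]
    by_cases h : z ∈ dirichletSet Γ
    · rw [Set.indicator_of_mem h, Set.indicator_of_mem (this.mpr h)]
    · rw [Set.indicator_of_notMem h, Set.indicator_of_notMem (mt this.mp h)]
  simp only [hind]
  rw [lintegral_hypMeasure, differentialNormSq,
    setLIntegral_congr_fun hmeas fun z hz => enorm_associatedDifferential_sq Γ f n hz.1]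
  rw [← lintegral_indicator hmeas, ← lintegral_indicator Metric.isOpen_ball.measurableSet]
  refine lintegral_congr fun z => ?_
  by_cases h : z ∈ dirichletDomain Γ
  · rw [Set.indicator_of_mem h, Set.indicator_of_mem (hsub h), Set.indicator_of_mem h]
  · rw [Set.indicator_of_notMem h]
    by_cases h' : z ∈ Metric.ball (0 : ℂ) 1
    · rw [Set.indicator_of_mem h', Set.indicator_of_notMem h, mul_zero]
    · rw [Set.indicator_of_notMem h']

theorem fiberMean_one_ne_top_of_hardyNormSq {Γ : Subgroup (Equiv.Perm 𝔻)}
    (hΓ : IsCocompactFreeFuchsian Γ) {f : DiscBundle Γ → ℂ} (hf : IsHolomorphic Γ f)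
    (h : hardyNormSq Γ f < ⊤) : fiberMean Γ (bidiscLift Γ f) 1 ≠ ⊤ := by
  have hF := hf.isInvariantHolomorphic
  have hsum : ∑' n : ℕ, differentialNormSq Γ n (associatedDifferential Γ f n) ≠ ⊤ := by
    intro htop
    rw [hardyNormSq, htop, ENNReal.mul_top] at h
    · exact lt_irrefl _ h
    · rw [Ne, ENNReal.ofReal_eq_zero, not_le]
      exact Real.pi_pos
  refine ne_top_of_le_ne_top hsum ?_
  have hm : ∀ n, Measurable fun z : 𝔻 => dirichletWeight Γ z *
      ‖coeffAtZero (fiberMap (bidiscLift Γ f) z) n‖ₑ ^ 2 := fun n =>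
    hΓ.measurable_dirichletWeight.mul ((continuous_coeffAtZero hF.differentiableOn_fiberMap
      hF.continuous_fiberMap n).enorm.measurable.pow_const 2)
  simp only [fiberMean, sqSeries_one, ← ENNReal.tsum_mul_left]
  rw [lintegral_tsum fun n => (hm n).aemeasurable]
  refine ENNReal.tsum_le_tsum fun n => ?_
  rw [differentialNormSq_associatedDifferential hΓ,
    ← lintegral_indicator hΓ.measurableSet_dirichletSet]
  -- The weight is at most the indicator of the Dirichlet domain over which the Hardy norm
  -- integrates; this one inequality suffices for finiteness.
  refine lintegral_mono fun z => (mul_le_mul_left (hΓ.dirichletWeight_le z) _).trans ?_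
  by_cases hz : z ∈ dirichletSet Γ
  · simp [hz]
  · simp [hz]

theorem const_mem_hardySpace {Γ : Subgroup (Equiv.Perm 𝔻)} (hΓ : IsCocompactFreeFuchsian Γ)
    {f : DiscBundle Γ → ℂ} {c : ℂ} (hf : ∀ x, f x = c) : f ∈ hardySpace Γ := by
  have hlift : ∀ z w : 𝔻, bidiscLift Γ f (z, w) = c := fun z w => by
    rw [bidiscLift_coe, hf]
  refine ⟨?_, ?_⟩
  · refine (differentiableOn_const c).congr fun p hp => ?_
    obtain ⟨z, w⟩ := p
    lift z to 𝔻 using mem_ball_zero_iff.mp hp.1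
    lift w to 𝔻 using mem_ball_zero_iff.mp hp.2
    exact hlift z w
  · have hcoeff : ∀ (z : 𝔻) (n : ℕ), coeffAtZero (fiberMap (bidiscLift Γ f) z) n
        = if n = 0 then c else 0 := by
      intro z n
      have hev : fiberMap (bidiscLift Γ f) z =ᶠ[nhds 0] fun _ => c := by
        filter_upwards [Metric.ball_mem_nhds (0 : ℂ) one_pos] with t ht
        lift t to 𝔻 using mem_ball_zero_iff.mp ht
        exact hlift z (diskMove z t)
      rw [coeffAtZero, (hev.iteratedDeriv n).eq_of_nhds, iteratedDeriv_const]
      rcases eq_or_ne n 0 with rfl | hn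
      · simp
      · simp [hn]
    -- Only the zeroth differential survives, and its norm is finite because the Dirichlet domain
    -- has finite area.
    rw [hardyNormSq, tsum_eq_single 0]
    · refine ENNReal.mul_lt_top ENNReal.ofReal_lt_top ?_
      rw [differentialNormSq_associatedDifferential hΓ]
      simp only [hcoeff, if_true]
      rw [setLIntegral_const]
      exact ENNReal.mul_lt_top (ENNReal.pow_lt_top enorm_lt_top) hΓ.hypMeasure_dirichletSet_lt_top
    · intro n hn
      rw [differentialNormSq_associatedDifferential hΓ]
      simp [hcoeff, hn]

theorem corollary2 (Γ : Subgroup (Equiv.Perm 𝔻)) (hΓ : IsCocompactFreeFuchsian Γ) :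
    hardySpace Γ = {f : DiscBundle Γ → ℂ | ∃ c : ℂ, ∀ x, f x = c} ∧
      ∀ f : DiscBundle Γ → ℂ, IsHolomorphic Γ f → (∃ C : ℝ, ∀ x, ‖f x‖ ≤ C) →
        ∃ c : ℂ, ∀ x, f x = c := by
  refine ⟨Set.Subset.antisymm ?_ ?_, ?_⟩
  · rintro f ⟨hf, hfin⟩
    exact exists_eq_const_of_bidiscLift (hf.isInvariantHolomorphic.exists_eq_const hΓ
      (fiberMean_one_ne_top_of_hardyNormSq hΓ hf hfin))
  · rintro f ⟨c, hc⟩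
    exact const_mem_hardySpace hΓ hc
  · rintro f hf ⟨C, hC⟩
    have hF := hf.isInvariantHolomorphic
    refine exists_eq_const_of_bidiscLift (hF.exists_eq_const hΓ
      (hF.fiberMean_one_ne_top_of_bounded hΓ (C := C) fun z w => ?_))
    rw [bidiscLift_coe]
    exact hC _
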